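/- **Theorem (Local extension).** Let $0\le s\le n$, $r>0$, let $X=B(0,r)\subset\mathbb C^n$ be the open ball, $H=\{x_1\cdots x_s=0\}$, $X_0=X\setminus H$, and let $\pi:\tilde X_0\to X_0$ be the universal covering. Let $\rho:\pi_1(X_0,x_0)\to\mathrm{Aut}(\mathbb D)$ be a morphism and let $\mathcal D:\tilde X_0\to\mathbb D$ be a $\rho$-equivariant holomorphic map, $\mathcal D(\gamma\cdot e)=\rho(\gamma)(\mathcal D(e))$; regard it as a multivalued holomorphic map $f$ on $X_0$ (whose branches are $\mathcal D\circ\varphi$ for local sections $\varphi$ of $\pi$). Say that $\rho$ is * of *elliptic type* (via $h$) if $h\in\mathrm{Aut}(\mathbb D)$ and every $h\rho(\gamma)h^{-1}$ is a rotation $z\mapsto a_\gamma z$, $|a_\gamma|=1$; * of *parabolic type* (via $h$) if $h:\mathbb D\to\mathbb H$ is a biholomorphism onto the upper half-plane and every $h\rho(\gamma)h^{-1}$ is a translation $z\mapsto z+a_\gamma$, $a_\gamma\in\mathbb R$; * of *hyperbolic type* if $\rho$ is non-trivial and there is a biholomorphism $h:\mathbb D\to\mathbb H$ such that every $h\rho(\gamma)h^{-1}$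 is a homothety $z\mapsto a_\gamma z$, $a_\gamma\in(0,\infty)$. Then: 0. If $f$ is non-constant, then $\rho$ is not of hyperbolic type. 1. If $\rho$ is of parabolic type via $h$, there are a holomorphic function $g$ on $X$ and real numbers $\lambda_1,\dots,\lambda_s\ge 0$ such that $$h\circ f=\frac1{2i\pi}\sum_{i=1}^s\lambda_i\log x_i+g$$ on $\tilde X_0$, for suitable determinations of the $\log x_i$ on $\tilde X_0$. 2. If $\rho$ is of elliptic type via $h$, there are a holomorphic function $u:X\to\mathbb C$ and real numbers $\nu_1,\dots,\nu_s\in[0,1)$ such that $$h\circ f=u\prod_{i=1}^s x_i^{\nu_i}$$ on $\tilde X_0$, where $x_i^{\nu_i}=\exp(\nu_i\log x_i)$ for suitable determinations of the $\log x_i$ on $\tilde X_0$. 3. If $f$ is non-constant, the codimension one foliation on $X_0$ defined by the level sets of $f$ extends to a codimension one singular holomorphic foliation $\mathcal F$ on $X$ (given by a holomorphic $1$-form $\omega\not\equiv0$ with $\omega\wedge d\omega=0$), and its transverse hyperbolic structure on $X_0$ extends to $X$, perhaps with poles along $H$: there are a flat meromorphic connection $\nabla=d+A$ on the trivial rank two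 bundle over $X$, holomorphic on $X_0$, and a meromorphic section $\sigma$ of the associated $\mathbb P^1$-bundle, such that $\mathcal F$ is the pullback by $\sigma$ of the Riccati foliation (whose leaves are the projectivized flat sections of $\nabla$) and $\mathcal D$ is a developing map on $\tilde X_0$ of $(\nabla,\sigma)|_{X_0}$, i.e. $\mathcal D$ is the expression of $\sigma\circ\pi$ in a projective frame of $\nabla$-flat coordinates over $\tilde X_0$. -/

import Mathlib

open scoped Complex.UnitDisc UpperHalfPlane

noncomputable section

/-- The complex Euclidean space `ℂⁿ`. -/
abbrev Cn (n : ℕ) : Type := EuclideanSpace ℂ (Fin n)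

/-! ### Automorphisms of the disc and types of representations -/

/-- A bijection between two subsets of `ℂ` (given as types with their inclusions `a`, `b` in `ℂ`)
is biholomorphic if it and its inverse are holomorphic. -/
def IsBiholomorphism {A B : Type} (a : A → ℂ) (b : B → ℂ) (h : A ≃ B) : Prop :=
  (∃ g : ℂ → ℂ, DifferentiableOn ℂ g (Set.range a) ∧ ∀ z, b (h z) = g (a z)) ∧
  (∃ g : ℂ → ℂ, DifferentiableOn ℂ g (Set.range b) ∧ ∀ w, a (h.symm w) = g (b w))

theorem IsBiholomorphism.symm {A B : Type} {a : A → ℂ} {b : B → ℂ} {h : A ≃ B}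
    (H : IsBiholomorphism a b h) : IsBiholomorphism b a h.symm :=
  ⟨H.2, H.1⟩

theorem IsBiholomorphism.trans {A B C : Type} {a : A → ℂ} {b : B → ℂ} {c : C → ℂ}
    {h : A ≃ B} {k : B ≃ C} (H : IsBiholomorphism a b h) (K : IsBiholomorphism b c k) :
    IsBiholomorphism a c (h.trans k) := by
  obtain ⟨⟨g₁, hg₁, e₁⟩, ⟨g₂, hg₂, e₂⟩⟩ := H
  obtain ⟨⟨k₁, hk₁, f₁⟩, ⟨k₂, hk₂, f₂⟩⟩ := K
  refine ⟨⟨k₁ ∘ g₁, hk₁.comp hg₁ ?_, fun z => ?_⟩, ⟨g₂ ∘ k₂, hg₂.comp hk₂ ?_, fun z => ?_⟩⟩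
  · rintro _ ⟨z, rfl⟩
    exact ⟨h z, e₁ z⟩
  · simp [f₁, e₁]
  · rintro _ ⟨z, rfl⟩
    exact ⟨k.symm z, f₂ z⟩
  · simp [f₂, e₂]

/-- `Aut(𝔻)`: the group of biholomorphic self-maps of the unit disc, under composition. -/
def DiscAut : Subgroup (Equiv.Perm 𝔻) where
  carrier := {σ | IsBiholomorphism Complex.UnitDisc.coe Complex.UnitDisc.coe σ}
  one_mem' := ⟨⟨id, differentiableOn_id, fun _ => rfl⟩, ⟨id, differentiableOn_id, fun _ => rfl⟩⟩
  mul_mem' := fun {_ _} hσ hτ => IsBiholomorphism.trans hτ hσ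
  inv_mem' := fun {_} hσ => IsBiholomorphism.symm hσ

/-- Every `h ρ(γ) h⁻¹` is a rotation `z ↦ a z`, `|a| = 1`, where `h ∈ Aut(𝔻)`. -/
def IsEllipticVia {G : Type*} [Group G] (ρ : G →* DiscAut) (h : DiscAut) : Prop :=
  ∀ γ : G, ∃ a : Circle, ∀ z : 𝔻, (h * ρ γ * h⁻¹ : DiscAut).1 z = a • z

/-- Every `h ρ(γ) h⁻¹` is a real translation, where `h : 𝔻 → ℍ` is biholomorphic. -/
def IsParabolicVia {G : Type*} [Group G] (ρ : G →* DiscAut) (h : 𝔻 ≃ ℍ) : Prop :=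
  IsBiholomorphism Complex.UnitDisc.coe UpperHalfPlane.coe h ∧
  ∀ γ : G, ∃ a : ℝ, ∀ w : ℍ, (h ((ρ γ).1 (h.symm w)) : ℂ) = (w : ℂ) + (a : ℂ)

/-- `ρ` is nontrivial and, for some biholomorphic `h : 𝔻 → ℍ`, every `h ρ(γ) h⁻¹` is a real
homothety `w ↦ a w`, `a > 0`. -/
def IsHyperbolicType {G : Type*} [Group G] (ρ : G →* DiscAut) : Prop :=
  ρ ≠ 1 ∧ ∃ h : 𝔻 ≃ ℍ, IsBiholomorphism Complex.UnitDisc.coe UpperHalfPlane.coe h ∧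
    ∀ γ : G, ∃ a : ℝ, 0 < a ∧ ∀ w : ℍ, (h ((ρ γ).1 (h.symm w)) : ℂ) = (a : ℂ) * (w : ℂ)

/-! ### Multivalued functions on the complement of coordinate hyperplanes -/

/-- `X₀ = B(0, r) ∖ {x₁ ⋯ x_s = 0}` in `ℂⁿ`. -/
def ballCompl (n s : ℕ) (hs : s ≤ n) (r : ℝ) : Set (Cn n) :=
  {x | x ∈ Metric.ball (0 : Cn n) r ∧ ∀ i : Fin s, x (Fin.castLE hs i) ≠ 0}

section Cover

variable {n : ℕ} {X₀ : Set (Cn n)} {E : Type*} [TopologicalSpace E]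

/-- `φ` is a continuous section over the open set `U` of the map `p : E → X₀`. -/
def IsLocalSection (p : E → X₀) (U : Set (Cn n)) (φ : Cn n → E) : Prop :=
  IsOpen U ∧ ContinuousOn φ U ∧ ∀ x ∈ U, (p (φ x) : Cn n) = x

/-- A function on the total space of a covering `p` of the open set `X₀` is holomorphic if all its
branches `F ∘ φ` are. -/
def IsHolomorphicOnCover (p : E → X₀) (F : E → ℂ) : Prop :=
  ∀ (U : Set (Cn n)) (φ : Cn n → E), IsLocalSection p U φ →
    DifferentiableOn ℂ (fun x => F (φ x)) U

/-- `D(γ · e) = ρ(γ)(D(e))`, where the class of a loop `γ` at `p e₀` acts on the universal covering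
`p` by the deck transformation `τ` sending `e₀` to the endpoint of the lift `Γ` of `γ` at `e₀`. -/
def IsEquivariant (p : E → X₀) (e₀ : E) (ρ : FundamentalGroup X₀ (p e₀) →* DiscAut)
    (D : E → 𝔻) : Prop :=
  ∀ (τ : E ≃ₜ E), (∀ e, p (τ e) = p e) →
    ∀ (γ : Path (p e₀) (p e₀)) (Γ : Path e₀ (τ e₀)), (∀ t, p (Γ t) = γ t) →
      ∀ e, D (τ e) = (ρ (FundamentalGroup.fromPath (Path.Homotopic.Quotient.mk γ))).1 (D e)

/-- `ℓ` is a determination of `log x_i` on the covering `p`. -/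
def IsLogBranch (p : E → X₀) (i : Fin n) (ℓ : E → ℂ) : Prop :=
  Continuous ℓ ∧ ∀ e, Complex.exp (ℓ e) = (p e : Cn n) i

end Cover

/-! ### Foliations and transverse projective structures -/

/-- A function on `X` that vanishes identically on no nonempty open subset of `X`. -/
def GenericallyNonzero {n : ℕ} {V : Type*} [Zero V] (X : Set (Cn n)) (f : Cn n → V) : Prop :=
  ∀ U : Set (Cn n), IsOpen U → U.Nonempty → U ⊆ X → ∃ x ∈ U, f x ≠ 0

/-- The exterior derivative of a `1`-form: `dη(v, w)` at `x`. -/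
def dForm {n : ℕ} (η : Cn n → (Cn n →L[ℂ] ℂ)) (x v w : Cn n) : ℂ :=
  fderiv ℂ η x v w - fderiv ℂ η x w v

/-- A codimension one singular holomorphic foliation on `X`, given by a defining holomorphic
`1`-form `ω`, generically nonzero and integrable: `ω ∧ dω = 0`. Two forms give the same foliation
when they have the same tangent sheaf. -/
structure CodimOneFoliation {n : ℕ} (X : Set (Cn n)) where
  form : Cn n → (Cn n →L[ℂ] ℂ)
  holomorphic : DifferentiableOn ℂ form X
  nonzero : GenericallyNonzero X form
  integrable : ∀ x ∈ X, ∀ u v w : Cn n,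
    form x u * dForm form x v w + form x v * dForm form x w u + form x w * dForm form x u v = 0

/-- The sections over `U` of the tangent sheaf of the foliation. -/
def CodimOneFoliation.tangent {n : ℕ} {X : Set (Cn n)} (F : CodimOneFoliation X)
    (U : Set (Cn n)) : Set (Cn n → Cn n) :=
  {v | DifferentiableOn ℂ v U ∧ ∀ x ∈ U, F.form x (v x) = 0}

/-- The foliation restricts to the foliation by the level sets of the multivalued function `f` with
determination `D` on the covering `p`: over each open `U` with a branch `f = D ∘ φ`, the tangent
sheaf consists of the vector fields `v` with `df(v) = 0`. -/
def CodimOneFoliation.DefinedByLevelSets {n : ℕ} {X X₀ : Set (Cn n)} {E : Type*}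
    [TopologicalSpace E] (F : CodimOneFoliation X) (p : E → X₀) (D : E → ℂ) : Prop :=
  ∀ (U : Set (Cn n)) (φ : Cn n → E), IsLocalSection p U φ →
    F.tangent U =
      {v | DifferentiableOn ℂ v U ∧ ∀ x ∈ U, fderiv ℂ (fun y => D (φ y)) x (v x) = 0}

/-- On the trivial rank two bundle over `X`: a flat meromorphic connection `∇ = d + A`,
`A = B / q` with `B`, `q` holomorphic, and a meromorphic section `[σ₀ : σ₁]` of its
projectivization. -/
structure ProjectiveTriple {n : ℕ} (X : Set (Cn n)) where
  q : Cn n → ℂ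
  B : Fin 2 → Fin 2 → Cn n → (Cn n →L[ℂ] ℂ)
  σ : Cn n → (Fin 2 → ℂ)
  q_holomorphic : DifferentiableOn ℂ q X
  B_holomorphic : ∀ i j, DifferentiableOn ℂ (B i j) X
  σ_holomorphic : DifferentiableOn ℂ σ X
  q_nonzero : GenericallyNonzero X q
  σ_nonzero : GenericallyNonzero X σ
  flat : ∀ x ∈ X, q x ≠ 0 → ∀ (i j : Fin 2) (v w : Cn n),
    dForm (fun y => (q y)⁻¹ • B i j y) x v w +
      ∑ k, (((q x)⁻¹ • B i k x) v * ((q x)⁻¹ • B k j x) w -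
        ((q x)⁻¹ • B i k x) w * ((q x)⁻¹ • B k j x) v) = 0

namespace ProjectiveTriple

variable {n : ℕ} {X : Set (Cn n)}

/-- The connection matrix `A = B / q`, meaningful where `q ≠ 0`. -/
def A (S : ProjectiveTriple X) (i j : Fin 2) (x : Cn n) : Cn n →L[ℂ] ℂ :=
  (S.q x)⁻¹ • S.B i j x

/-- The components of `∇_v σ = dσ(v) + A(v) σ`. -/
def covDeriv (S : ProjectiveTriple X) (x v : Cn n) (i : Fin 2) : ℂ :=
  fderiv ℂ S.σ x v i + ∑ j, S.A i j x v * S.σ x j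

/-- The `1`-form `v ↦ σ ∧ ∇_v σ`, which defines the pullback by `[σ]` of the Riccati foliation
whose leaves are the projectivized flat sections of `∇`. -/
def riccatiForm (S : ProjectiveTriple X) (x v : Cn n) : ℂ :=
  S.σ x 0 * S.covDeriv x v 1 - S.σ x 1 * S.covDeriv x v 0

/-- The triple is a transverse projective structure for `F`: off the poles of the connection, the
pullback by `[σ]` of the Riccati foliation is `F`. -/
def IsTransverseStructureFor (S : ProjectiveTriple X) (F : CodimOneFoliation X) : Prop :=
  ∀ U : Set (Cn n), IsOpen U → U ⊆ X → (∀ x ∈ U, S.q x ≠ 0) →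
    F.tangent U = {v | DifferentiableOn ℂ v U ∧ ∀ x ∈ U, S.riccatiForm x (v x) = 0}

/-- `D` is a developing map of the structure over `X₀`, along the covering `p`: in a frame of flat
projective coordinates, given by a multivalued holomorphic invertible `Φ` with `dΦ = Φ A`, the
section `[σ]` becomes `[Φ σ] = [D : 1]`. -/
def IsDevelopingMap (S : ProjectiveTriple X) {X₀ : Set (Cn n)} {E : Type*} [TopologicalSpace E]
    (p : E → X₀) (D : E → ℂ) : Prop :=
  ∃ Φ : E → Matrix (Fin 2) (Fin 2) ℂ,
    (∀ e, (Φ e).det ≠ 0) ∧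
    (∀ i j, IsHolomorphicOnCover p (fun e => Φ e i j)) ∧
    (∀ (U : Set (Cn n)) (φ : Cn n → E), IsLocalSection p U φ → ∀ x ∈ U, ∀ (v : Cn n) (i j : Fin 2),
      fderiv ℂ (fun y => Φ (φ y) i j) x v = ∑ k, Φ (φ x) i k * S.A k j x v) ∧
    ∀ e, (Φ e).mulVec (S.σ (p e)) 0 = D e * (Φ e).mulVec (S.σ (p e)) 1

end ProjectiveTriple

end

section

open Complex Metric Set Filter Topology
open scoped MatrixGroups

/-! Exponentiating the first `s` coordinates identifies the universal covering with the convex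
domain `logDomain`, deck transformations becoming translations by `2πiℤˢ`
(`nonempty_uniformization`). The map `D` then becomes a holomorphic function `G` on `logDomain` with
prescribed behaviour under these translations.

In the parabolic case, subtracting a linear form from `G` removes the periods. The rest descends to
the complement of `H`, and positivity of `Im G` bounds its imaginary part below by a logarithm. A
function on a punctured disc whose real part is at most logarithmic is bounded
(`exists_norm_le_of_re_le_log`), so the Riemann extension theorem applies, and a negative residue
would contradict boundedness (`parabolic_extension`). In the elliptic case, dividing by an
exponential leaves growth `|x_i|^(-ν_i)` with `ν_i < 1`, which is removable (`elliptic_extension`).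
A homothety becomes a translation after taking `log G`; applying the parabolic case to both `log G`
and `πi - log G` makes the translation length both nonnegative and nonpositive, hence zero
(`homothety_eq_one`).

For the foliation, the generators act on the half-plane by real Möbius maps that commute once `G` is
nonconstant. They share a fixed point in `ℍ`, or are simultaneously conjugate to translations, or to
homotheties; the last is excluded. So `D` is a homography of `W = u ∏ x_i^ν_i + ∑ μ_i log x_i` with
`ν = 0` or `μ = 0` (`MobiusEquivariant.hasNormalForm`). Up to a nonvanishing factor `dW` is a
single-valued form extending over `H`, and the explicit triangular connection `elementaryTriple`
with the section `[u : 1]` has `D` as developing map. -/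

/-! ### Holomorphic functions of several variables: circle integrals and second derivatives. -/

theorem differentiableAt_circleIntegral_comp_add_smul {n : ℕ} {W : Set (Cn n)} (hW : IsOpen W)
    {f : Cn n → ℂ} (hf : DifferentiableOn ℂ f W) {x₀ v : Cn n} {ε : ℝ} (hε : 0 ≤ ε) {k : ℂ → ℂ}
    (hk : ContinuousOn k (sphere 0 ε)) (h : ∀ ζ ∈ sphere (0 : ℂ) ε, x₀ + ζ • v ∈ W) :
    DifferentiableAt ℂ (fun x => ∮ ζ in C(0, ε), k ζ * f (x + ζ • v)) x₀ := by
  have hcirc : ∀ θ : ℝ, circleMap 0 ε θ ∈ sphere (0 : ℂ) ε := fun θ =>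
    circleMap_mem_sphere _ hε θ
  have hcont : Continuous fun ζ : ℂ => x₀ + ζ • v := by fun_prop
  have hK : IsCompact ((fun ζ : ℂ => x₀ + ζ • v) '' sphere 0 ε) := (isCompact_sphere _ _).image hcont
  obtain ⟨δ, hδ, hδW⟩ := hK.exists_cthickening_subset_open hW (by
    rintro _ ⟨ζ, hζ, rfl⟩; exact h ζ hζ)
  obtain ⟨M, hM⟩ := (hK.cthickening (r := δ)).exists_bound_of_continuousOn
    (hf.continuousOn.mono hδW)
  have hnear : ∀ ζ ∈ sphere (0 : ℂ) ε, ∀ y : Cn n, dist y (x₀ + ζ • v) ≤ δ →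
      y ∈ cthickening δ ((fun ζ : ℂ => x₀ + ζ • v) '' sphere 0 ε) := fun ζ hζ y hy =>
    mem_cthickening_of_dist_le y _ δ _ ⟨ζ, hζ, rfl⟩ hy
  have hxd : ∀ (ζ : ℂ) (x : Cn n), dist (x + ζ • v) (x₀ + ζ • v) = dist x x₀ := fun ζ x => by simp
  -- Cauchy estimate on balls of radius `δ / 2`, where `f` deviates from its central value by at
  -- most `2 * M`. The bound is uniform in `ζ` and `x`, as domination requires.
  have hderiv : ∀ ζ ∈ sphere (0 : ℂ) ε, ∀ x ∈ ball x₀ (δ / 2),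
      ‖fderiv ℂ f (x + ζ • v)‖ ≤ 2 * M / (δ / 2) := by
    intro ζ hζ x hx
    have hsub : ball (x + ζ • v) (δ / 2) ⊆
        cthickening δ ((fun ζ : ℂ => x₀ + ζ • v) '' sphere 0 ε) := by
      intro y hy
      refine hnear ζ hζ y ?_
      have := dist_triangle y (x + ζ • v) (x₀ + ζ • v)
      rw [hxd] at this
      have h1 := mem_ball.1 hx
      have h2 := mem_ball.1 hy
      linarith
    refine Complex.norm_fderiv_le_div_of_mapsTo_ball (hf.mono (hsub.trans hδW)) ?_ (by positivity)
    intro y hy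
    rw [mem_closedBall, dist_eq_norm]
    have h1 := hM y (hsub hy)
    have h2 := hM (x + ζ • v) (hsub (mem_ball_self (by positivity)))
    linarith [norm_sub_le (f y) (f (x + ζ • v))]
  obtain ⟨Mk, hMk⟩ := (isCompact_sphere (0 : ℂ) ε).exists_bound_of_continuousOn hk
  have hM0 : ∀ x ∈ ball x₀ (δ / 2), Continuous fun θ : ℝ =>
      deriv (circleMap 0 ε) θ • (k (circleMap 0 ε θ) * f (x + circleMap 0 ε θ • v)) := by
    intro x hx
    have h1 : Continuous fun θ : ℝ => k (circleMap 0 ε θ) :=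
      hk.comp_continuous (continuous_circleMap _ _) hcirc
    have h2 : Continuous fun θ : ℝ => f (x + circleMap 0 ε θ • v) := by
      refine hf.continuousOn.comp_continuous (by fun_prop) fun θ => hδW (hnear _ (hcirc θ) _ ?_)
      rw [hxd]; linarith [mem_ball.1 hx]
    simp only [deriv_circleMap]
    exact ((continuous_circleMap 0 ε).mul continuous_const).smul (h1.mul h2)
  have hx0 : x₀ ∈ ball x₀ (δ / 2) := mem_ball_self (by positivity)
  have : SecondCountableTopology (Cn n →L[ℂ] ℂ) :=
    have : ProperSpace (Cn n →L[ℂ] ℂ) := FiniteDimensional.proper ℂ _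
    inferInstance
  refine (intervalIntegral.hasFDerivAt_integral_of_dominated_of_fderiv_le
    (F' := fun x θ => deriv (circleMap 0 ε) θ • (k (circleMap 0 ε θ) •
      fderiv ℂ f (x + circleMap 0 ε θ • v)))
    (bound := fun _ => |ε| * (Mk * (2 * M / (δ / 2))))
    (ball_mem_nhds x₀ (half_pos hδ)) ?_ ?_ ?_ ?_ ?_ ?_).differentiableAt
  · filter_upwards [ball_mem_nhds x₀ (half_pos hδ)] with x hx
    exact (hM0 x hx).aestronglyMeasurable
  · exact (hM0 x₀ hx0).intervalIntegrable _ _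
  · have h1 : Continuous fun θ : ℝ => k (circleMap 0 ε θ) :=
      hk.comp_continuous (continuous_circleMap _ _) hcirc
    have h2 : Measurable fun θ : ℝ => fderiv ℂ f (x₀ + circleMap 0 ε θ • v) :=
      (measurable_fderiv ℂ f).comp (by fun_prop : Continuous fun θ : ℝ =>
        x₀ + circleMap 0 ε θ • v).measurable
    have h3 : Continuous fun θ : ℝ => deriv (circleMap 0 ε) θ := by
      simp only [deriv_circleMap]; fun_prop
    exact h3.aestronglyMeasurable.smul (h1.aestronglyMeasurable.smul h2.aestronglyMeasurable)
  · refine Eventually.of_forall fun θ _ x hx => ?_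
    rw [norm_smul, norm_smul]
    have : ‖deriv (circleMap 0 ε) θ‖ = |ε| := by simp [deriv_circleMap]
    rw [this]
    gcongr
    · exact (norm_nonneg _).trans (hMk _ (hcirc θ))
    · exact hMk _ (hcirc θ)
    · exact hderiv _ (hcirc θ) x hx
  · exact continuous_const.intervalIntegrable _ _
  · refine Eventually.of_forall fun θ _ x hx => ?_
    have hmem : x + circleMap 0 ε θ • v ∈ W := hδW (hnear _ (hcirc θ) _ (by
      rw [hxd]; linarith [mem_ball.1 hx]))
    have h1 : HasFDerivAt f (fderiv ℂ f (x + circleMap 0 ε θ • v)) (x + circleMap 0 ε θ • v) :=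
      (hf.differentiableAt (hW.mem_nhds hmem)).hasFDerivAt
    have h2 : HasFDerivAt (fun x : Cn n => f (x + circleMap 0 ε θ • v))
        (fderiv ℂ f (x + circleMap 0 ε θ • v)) x := by
      simpa using (hasFDerivAt_comp_add_right (circleMap 0 ε θ • v)).2 h1
    exact (h2.const_smul (k (circleMap 0 ε θ))).const_smul (deriv (circleMap 0 ε) θ)

theorem deriv_comp_add_smul_zero {n : ℕ} {f : Cn n → ℂ} {x : Cn n} (hf : DifferentiableAt ℂ f x)
    (v : Cn n) : HasDerivAt (fun ζ : ℂ => f (x + ζ • v)) (fderiv ℂ f x v) 0 := by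
  have h1 : HasDerivAt (fun ζ : ℂ => x + ζ • v) v 0 := by
    simpa using ((hasDerivAt_id (0 : ℂ)).smul_const v).const_add x
  have h2 : HasFDerivAt f (fderiv ℂ f x) (x + (0 : ℂ) • v) := by simpa using hf.hasFDerivAt
  exact h2.comp_hasDerivAt (0 : ℂ) h1

/-- A directional derivative of a holomorphic function of several variables is holomorphic. -/
theorem differentiableOn_fderiv_apply {n : ℕ} {U : Set (Cn n)} (hU : IsOpen U) {f : Cn n → ℂ}
    (hf : DifferentiableOn ℂ f U) (v : Cn n) :
    DifferentiableOn ℂ (fun x => fderiv ℂ f x v) U := by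
  intro a ha
  refine DifferentiableAt.differentiableWithinAt ?_
  obtain ⟨ρ, hρ, hball⟩ := Metric.isOpen_iff.1 hU a ha
  -- Discs of radius `ε` in the direction `v`, centred within `ρ / 2` of `a`, stay in `U`; the `+ 1`
  -- covers `v = 0`. Cauchy's formula on them writes the derivative as a circle integral.
  set ε : ℝ := ρ / 2 / (‖v‖ + 1) with hεdef
  have hε : 0 < ε := by positivity
  have hεv : ε * ‖v‖ < ρ / 2 := by
    rw [hεdef, div_mul_eq_mul_div, div_lt_iff₀ (by positivity)]; nlinarith [norm_nonneg v]
  have hin : ∀ x ∈ ball a (ρ / 2), ∀ ζ ∈ closedBall (0 : ℂ) ε, x + ζ • v ∈ U := by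
    intro x hx ζ hζ
    apply hball
    rw [mem_ball, dist_eq_norm] at hx ⊢
    rw [mem_closedBall_zero_iff] at hζ
    calc ‖x + ζ • v - a‖ = ‖(x - a) + ζ • v‖ := by congr 1; abel
      _ ≤ ‖x - a‖ + ‖ζ‖ * ‖v‖ := (norm_add_le _ _).trans (by rw [norm_smul])
      _ < ρ / 2 + ρ / 2 := add_lt_add_of_lt_of_le hx
          ((mul_le_mul_of_nonneg_right hζ (norm_nonneg _)).trans hεv.le)
      _ = ρ := by ring
  have hk : ContinuousOn (fun ζ : ℂ => ((ζ - 0) ^ 2)⁻¹) (sphere 0 ε) := by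
    refine ContinuousOn.inv₀ (by fun_prop) fun ζ hζ => ?_
    have : ζ ≠ 0 := ne_zero_of_mem_sphere hε.ne' ⟨ζ, hζ⟩
    simpa using this
  have hdiff := (differentiableAt_circleIntegral_comp_add_smul hU hf hε.le hk (x₀ := a) (v := v)
    fun ζ hζ => hin a (mem_ball_self (by positivity)) ζ (sphere_subset_closedBall hζ)).const_mul
    (2 * Real.pi * I : ℂ)⁻¹
  refine hdiff.congr_of_eventuallyEq ?_
  filter_upwards [ball_mem_nhds a (half_pos hρ)] with x hx
  have hxU : x ∈ U := by simpa using hin x hx 0 (by simp [hε.le])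
  have hcontl : Continuous fun ζ : ℂ => x + ζ • v := by fun_prop
  have hd : DifferentiableOn ℂ (fun ζ : ℂ => f (x + ζ • v)) ((fun ζ : ℂ => x + ζ • v) ⁻¹' U) :=
    hf.comp (by fun_prop) fun ζ hζ => hζ
  have key := two_pi_I_inv_smul_circleIntegral_sub_sq_inv_smul_of_differentiable
    (hU.preimage hcontl) (hin x hx) hd (mem_ball_self hε)
  rw [(deriv_comp_add_smul_zero (hf.differentiableAt (hU.mem_nhds hxU)) v).deriv] at key
  exact key.symm

theorem fderiv_eq_sum_proj {n : ℕ} (L : Cn n →L[ℂ] ℂ) :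
    L = ∑ i, L (EuclideanSpace.single i 1) • (EuclideanSpace.proj i : Cn n →L[ℂ] ℂ) := by
  ext x
  conv_lhs => rw [← (EuclideanSpace.basisFun (Fin n) ℂ).sum_repr x]
  simp [mul_comm]

theorem differentiableOn_fderiv {n : ℕ} {U : Set (Cn n)} (hU : IsOpen U) {f : Cn n → ℂ}
    (hf : DifferentiableOn ℂ f U) : DifferentiableOn ℂ (fderiv ℂ f) U := by
  rw [funext fun x => fderiv_eq_sum_proj (fderiv ℂ f x)]
  exact DifferentiableOn.fun_sum fun i _ => (differentiableOn_fderiv_apply hU hf _).smul_const _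

theorem contDiffOn_one_of_differentiableOn {n : ℕ} {U : Set (Cn n)} (hU : IsOpen U) {f : Cn n → ℂ}
    (hf : DifferentiableOn ℂ f U) : ContDiffOn ℂ 1 f U :=
  (contDiffOn_succ_iff_fderiv_of_isOpen (n := 0) hU).2
    ⟨hf, by simp, contDiffOn_zero.2 (differentiableOn_fderiv hU hf).continuousOn⟩

/-- This is the regularity needed for the symmetry of second derivatives, hence for `d ∘ d = 0`. -/
theorem contDiffOn_two_of_differentiableOn {n : ℕ} {U : Set (Cn n)} (hU : IsOpen U) {f : Cn n → ℂ}
    (hf : DifferentiableOn ℂ f U) : ContDiffOn ℂ 2 f U := by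
  have h2 : ContDiffOn ℂ 1 (fderiv ℂ f) U := by
    rw [funext fun x => fderiv_eq_sum_proj (fderiv ℂ f x)]
    exact ContDiffOn.sum fun i _ => (contDiffOn_one_of_differentiableOn hU
      (differentiableOn_fderiv_apply hU hf _)).smul contDiffOn_const
  exact (contDiffOn_succ_iff_fderiv_of_isOpen (n := 1) hU).2 ⟨hf, by simp, h2⟩

theorem fderiv_fderiv_apply_comm {n : ℕ} {U : Set (Cn n)} (hU : IsOpen U) {f : Cn n → ℂ}
    (hf : DifferentiableOn ℂ f U) {x : Cn n} (hx : x ∈ U) (v w : Cn n) :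
    fderiv ℂ (fderiv ℂ f) x v w = fderiv ℂ (fderiv ℂ f) x w v :=
  (((contDiffOn_two_of_differentiableOn hU hf).contDiffAt (hU.mem_nhds hx)).isSymmSndFDerivAt
    (by simp)).eq v w

/-! ### Removable singularities and Riemann extension across coordinate hyperplanes. -/

/-- A one-variable function with finitely many singularities, each of them `o((z - c)⁻¹)`,
extends holomorphically. -/
theorem exists_differentiableOn_of_isLittleO_finite {U S : Set ℂ} (hU : IsOpen U) (hS : S.Finite)
    {φ : ℂ → ℂ} (hφ : DifferentiableOn ℂ φ (U \ S))
    (ho : ∀ c ∈ S ∩ U, φ =o[𝓝[≠] c] fun ζ => (ζ - c)⁻¹) :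
    ∃ ψ : ℂ → ℂ, DifferentiableOn ℂ ψ U ∧ ∀ ζ ∉ S, ψ ζ = φ ζ := by
  classical
  refine ⟨fun ζ => if ζ ∈ S then limUnder (𝓝[≠] ζ) φ else φ ζ, ?_, fun ζ hζ => if_neg hζ⟩
  intro c hc
  refine DifferentiableAt.differentiableWithinAt ?_
  by_cases hcS : c ∈ S
  · have hopen : IsOpen (U \ (S \ {c})) := hU.sdiff (hS.subset sdiff_subset).isClosed
    have hmem : U \ (S \ {c}) ∈ 𝓝 c := hopen.mem_nhds ⟨hc, fun h => h.2 rfl⟩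
    have hsub : (U \ (S \ {c})) \ {c} ⊆ U \ S := fun z hz =>
      ⟨hz.1.1, fun h => hz.1.2 ⟨h, hz.2⟩⟩
    -- The removability criterion concerns `φ - φ c`. The value `φ c` is arbitrary, but any constant
    -- is negligible against a function tending to infinity.
    have hconst : (fun _ : ℂ => φ c) =o[𝓝[≠] c] fun ζ => (ζ - c)⁻¹ := by
      refine (Asymptotics.isLittleO_const_left).2 (Or.inr ?_)
      refine tendsto_norm_atTop_iff_cobounded.2 ?_
      refine tendsto_inv₀_nhdsNE_zero.comp ?_
      refine tendsto_nhdsWithin_iff.2 ⟨?_, ?_⟩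
      · exact ((continuous_sub_right c).tendsto' c 0 (sub_self c)).mono_left nhdsWithin_le_nhds
      · filter_upwards [self_mem_nhdsWithin] with z hz using sub_ne_zero.2 hz
    have key := Complex.differentiableOn_update_limUnder_of_isLittleO hmem (hφ.mono hsub)
      ((ho c ⟨hcS, hc⟩).sub hconst)
    refine (key.differentiableAt hmem).congr_of_eventuallyEq ?_
    filter_upwards [hmem] with z hz
    by_cases hzc : z = c
    · subst hzc; simp [hcS]
    · have : z ∉ S := fun h => hz.2 ⟨h, hzc⟩
      simp [this, hzc]
  · have hopen : IsOpen (U \ S) := hU.sdiff hS.isClosed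
    refine (hφ.differentiableAt (hopen.mem_nhds ⟨hc, hcS⟩)).congr_of_eventuallyEq ?_
    filter_upwards [hopen.mem_nhds ⟨hc, hcS⟩] with z hz using if_neg hz.2

theorem eq_of_eventually_eq_nhdsWithin {X Y : Type*} [TopologicalSpace X] [TopologicalSpace Y]
    [T2Space Y] {f g : X → Y} {x : X} {S : Set X} (hf : ContinuousAt f x) (hg : ContinuousAt g x)
    (hx : x ∈ closure S) (h : ∀ᶠ y in 𝓝[S] x, f y = g y) : f x = g x := by
  have : (𝓝[S] x).NeBot := mem_closure_iff_nhdsWithin_neBot.1 hx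
  exact tendsto_nhds_unique_of_eventuallyEq (hf.tendsto.mono_left nhdsWithin_le_nhds)
    (hg.tendsto.mono_left nhdsWithin_le_nhds) h

theorem dense_forall_apply_ne_zero {n : ℕ} {ι : Type*} [Finite ι] (φ : ι → (Cn n →L[ℂ] ℂ))
    (hφ : ∀ i, φ i ≠ 0) : Dense {x | ∀ i, φ i x ≠ 0} := by
  have h : Dense (⋂ i, {x | φ i x ≠ 0}) := by
    refine dense_iInter_of_isOpen (fun i => isOpen_ne_fun (φ i).continuous continuous_const)
      fun i => ?_
    have : {x | φ i x ≠ 0} = ((φ i).toLinearMap.ker : Set (Cn n))ᶜ := by ext; simp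
    rw [this, ← interior_eq_empty_iff_dense_compl]
    by_contra hne
    have := Submodule.eq_top_of_nonempty_interior' _ (nonempty_iff_ne_empty.2 hne)
    refine hφ i (ContinuousLinearMap.ext fun x => ?_)
    have hx : x ∈ (φ i).toLinearMap.ker := this ▸ Submodule.mem_top
    simpa using hx
  rwa [← ofPred_forall] at h

section

variable {n s : ℕ} (hs : s ≤ n)

/-- Points none of whose first `s` coordinates vanish or coincide. -/
def genericSet : Set (Cn n) :=
  {x | (∀ j : Fin s, x (Fin.castLE hs j) ≠ 0) ∧
    ∀ j k : Fin s, j ≠ k → x (Fin.castLE hs j) ≠ x (Fin.castLE hs k)}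

/-- The line `x + ζ • (1, …, 1)` meets the `j`-th hyperplane at `ζ = -x_j`. For generic `x` these
parameters are distinct, so the line crosses the hyperplanes one at a time. -/
theorem dense_genericSet : Dense (genericSet hs) := by
  have h1 := dense_forall_apply_ne_zero
    (fun j : Fin s => (EuclideanSpace.proj (Fin.castLE hs j) : Cn n →L[ℂ] ℂ)) (fun j h => by
      have := congrArg (fun L => L (EuclideanSpace.single (Fin.castLE hs j) 1)) h
      simp at this)
  have h2 := dense_forall_apply_ne_zero
    (fun q : {q : Fin s × Fin s // q.1 ≠ q.2} =>
      (EuclideanSpace.proj (Fin.castLE hs q.1.1) - EuclideanSpace.proj (Fin.castLE hs q.1.2) :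
        Cn n →L[ℂ] ℂ)) (fun q h => by
      have := congrArg (fun L => L (EuclideanSpace.single (Fin.castLE hs q.1.1) 1)) h
      have hne := q.2
      simp [(Fin.castLE_injective hs).ne hne.symm] at this)
  refine (h1.inter_of_isOpen_left h2 ?_).mono ?_
  · rw [ofPred_forall]
    exact isOpen_iInter_of_finite fun i => isOpen_ne_fun
      (EuclideanSpace.proj (Fin.castLE hs i) : Cn n →L[ℂ] ℂ).continuous continuous_const
  · rintro x ⟨hx1, hx2⟩
    refine ⟨fun j => by simpa using hx1 j, fun j k hjk => ?_⟩
    have := hx2 ⟨(j, k), hjk⟩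
    simpa [sub_ne_zero] using this

theorem isOpen_ballCompl (r : ℝ) : IsOpen (ballCompl n s hs r) := by
  have : ballCompl n s hs r = ball 0 r ∩ ⋂ i : Fin s, {x : Cn n | x (Fin.castLE hs i) ≠ 0} := by
    ext x; simp [ballCompl]
  rw [this]
  exact isOpen_ball.inter (isOpen_iInter_of_finite fun i => isOpen_ne_fun (by fun_prop)
    continuous_const)

theorem ballCompl_subset_ball (r : ℝ) : ballCompl n s hs r ⊆ ball 0 r := fun _ hx => hx.1

theorem nhdsWithin_ballCompl_neBot {r : ℝ} {x : Cn n} (hx : x ∈ ball (0 : Cn n) r) :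
    (𝓝[ballCompl n s hs r] x).NeBot := by
  rw [← mem_closure_iff_nhdsWithin_neBot]
  have h := (dense_genericSet hs).open_subset_closure_inter isOpen_ball hx
  exact closure_mono (fun y (hy : y ∈ ball 0 r ∩ genericSet hs) =>
    show y ∈ ballCompl n s hs r from ⟨hy.1, hy.2.1⟩) h

/-- The vector all of whose coordinates are `1`. -/
def onesVec (n : ℕ) : Cn n := WithLp.toLp 2 fun _ => 1

@[simp] theorem onesVec_apply (n : ℕ) (i : Fin n) : onesVec n i = 1 := rfl

/-- **Riemann extension theorem** across coordinate hyperplanes: it is enough to control the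
function near points lying on exactly one of the hyperplanes, along a transverse line. -/
theorem exists_differentiableOn_ball_extension {r : ℝ} {f : Cn n → ℂ}
    (hf : DifferentiableOn ℂ f (ballCompl n s hs r))
    (ho : ∀ y ∈ ball (0 : Cn n) r, ∀ j : Fin s, y (Fin.castLE hs j) = 0 →
      (∀ k ≠ j, y (Fin.castLE hs k) ≠ 0) →
      (fun ζ : ℂ => f (y + ζ • onesVec n)) =o[𝓝[≠] 0] fun ζ => ζ⁻¹) :
    ∃ g : Cn n → ℂ, DifferentiableOn ℂ g (ball 0 r) ∧ ∀ x ∈ ballCompl n s hs r, g x = f x := by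
  set e := onesVec n
  -- For `x` in `N ε`, the disc of radius `ε` around `x` in the direction `e` lies in the ball and
  -- its boundary circle misses every hyperplane.
  let N : ℝ → Set (Cn n) := fun ε => {x | ‖x‖ + ε * ‖e‖ < r ∧ ∀ j : Fin s, ‖x (Fin.castLE hs j)‖ ≠ ε}
  have hNo : ∀ ε, IsOpen (N ε) := fun ε => by
    have : N ε = {x | ‖x‖ + ε * ‖e‖ < r} ∩ ⋂ j : Fin s, {x | ‖x (Fin.castLE hs j)‖ ≠ ε} := by
      ext; simp [N]
    rw [this]
    exact (isOpen_lt (by fun_prop) continuous_const).inter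
      (isOpen_iInter_of_finite fun j => isOpen_ne_fun (by fun_prop) continuous_const)
  have hex : ∀ a ∈ ball (0 : Cn n) r, ∃ ε > 0, a ∈ N ε := by
    intro a ha
    rw [mem_ball_zero_iff] at ha
    have h1 : ∀ᶠ ε : ℝ in 𝓝[>] 0, ‖a‖ + ε * ‖e‖ < r :=
      (((by fun_prop : Continuous fun ε : ℝ => ‖a‖ + ε * ‖e‖).tendsto' 0 ‖a‖ (by simp)).eventually
        (gt_mem_nhds ha)).filter_mono nhdsWithin_le_nhds
    have h2 : ∀ᶠ ε : ℝ in 𝓝[>] 0, ∀ j : Fin s, ‖a (Fin.castLE hs j)‖ ≠ ε := by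
      refine eventually_all.2 fun j => ?_
      rcases eq_or_ne (a (Fin.castLE hs j)) 0 with h | h
      · filter_upwards [self_mem_nhdsWithin] with ε hε
        rw [h, norm_zero]; exact (ne_of_lt hε)
      · filter_upwards [nhdsWithin_le_nhds (gt_mem_nhds (norm_pos_iff.2 h))] with ε hε
        exact hε.ne'
    obtain ⟨ε, ⟨h1, h2⟩, hε⟩ := ((h1.and h2).and self_mem_nhdsWithin).exists
    exact ⟨ε, hε, h1, h2⟩
  have hball : ∀ ε, ∀ x ∈ N ε, ∀ ζ ∈ closedBall (0 : ℂ) ε, x + ζ • e ∈ ball (0 : Cn n) r := by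
    intro ε x hx ζ hζ
    rw [mem_closedBall_zero_iff] at hζ
    rw [mem_ball_zero_iff]
    refine (norm_add_le _ _).trans_lt (lt_of_le_of_lt ?_ hx.1)
    rw [norm_smul]; gcongr
  have hsph : ∀ ε, ∀ x ∈ N ε, ∀ ζ ∈ sphere (0 : ℂ) ε, x + ζ • e ∈ ballCompl n s hs r := by
    intro ε x hx ζ hζ
    refine ⟨hball ε x hx ζ (sphere_subset_closedBall hζ), fun j h => hx.2 j ?_⟩
    rw [mem_sphere_zero_iff_norm] at hζ
    have : x (Fin.castLE hs j) + ζ = 0 := by simpa [e] using h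
    rw [eq_neg_of_add_eq_zero_left this, norm_neg, hζ]
  -- The Cauchy integral sees `f` only on that circle, so it is holomorphic even where `x` lies on
  -- hyperplanes.
  let G : ℝ → Cn n → ℂ := fun ε x => (2 * Real.pi * I : ℂ)⁻¹ * ∮ ζ in C(0, ε), (ζ - 0)⁻¹ * f (x + ζ • e)
  have hGd : ∀ ε > 0, ∀ x ∈ N ε, DifferentiableAt ℂ (G ε) x := by
    intro ε hε x hx
    have hk : ContinuousOn (fun ζ : ℂ => (ζ - 0)⁻¹) (sphere 0 ε) := by
      refine ContinuousOn.inv₀ (by fun_prop) fun ζ hζ => ?_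
      simpa using ne_zero_of_mem_sphere hε.ne' ⟨ζ, hζ⟩
    exact (differentiableAt_circleIntegral_comp_add_smul (isOpen_ballCompl hs r) hf hε.le hk
      (hsph ε x hx)).const_mul _
  have hGf : ∀ ε > 0, ∀ x ∈ N ε, x ∈ genericSet hs → G ε x = f x := by
    intro ε hε x hx hgen
    have hcont : Continuous fun ζ : ℂ => x + ζ • e := by fun_prop
    have hd : DifferentiableOn ℂ (fun ζ : ℂ => f (x + ζ • e))
        (((fun ζ : ℂ => x + ζ • e) ⁻¹' ball 0 r) \ range fun j : Fin s => -x (Fin.castLE hs j)) := by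
      refine hf.comp (by fun_prop) fun ζ hζ => ⟨hζ.1, fun j h => hζ.2 ⟨j, ?_⟩⟩
      have : x (Fin.castLE hs j) + ζ = 0 := by simpa [e] using h
      exact (eq_neg_of_add_eq_zero_right this).symm
    -- At a generic point the slice of `f` has only removable singularities, so Cauchy's formula
    -- returns `f x`.
    obtain ⟨ψ, hψ, hψf⟩ := exists_differentiableOn_of_isLittleO_finite
      (isOpen_ball.preimage hcont) (finite_range _) hd (by
        rintro c ⟨⟨j, rfl⟩, hc⟩
        have h0 := ho _ hc j (by simp [e]) (fun k hk h => hgen.2 k j hk (by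
          have : x (Fin.castLE hs k) + -x (Fin.castLE hs j) = 0 := by simpa [e] using h
          linear_combination this))
        have ht : Tendsto (fun ζ : ℂ => ζ - -x (Fin.castLE hs j)) (𝓝[≠] (-x (Fin.castLE hs j)))
            (𝓝[≠] 0) := by
          refine tendsto_nhdsWithin_iff.2 ⟨?_, ?_⟩
          · exact ((continuous_sub_right _).tendsto' _ 0 (sub_self _)).mono_left nhdsWithin_le_nhds
          · filter_upwards [self_mem_nhdsWithin] with z hz using sub_ne_zero.2 hz
        refine (h0.comp_tendsto ht).congr (fun ζ => ?_) (fun ζ => rfl)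
        simp only [Function.comp]
        congr 1
        module)
    have h0 : (0 : ℂ) ∉ range fun j : Fin s => -x (Fin.castLE hs j) := by
      rintro ⟨j, hj⟩; exact hgen.1 j (by simpa using hj)
    have hcb : closedBall (0 : ℂ) ε ⊆ (fun ζ : ℂ => x + ζ • e) ⁻¹' ball 0 r := hball ε x hx
    have key := (DifferentiableOn.diffContOnCl_ball hψ hcb).two_pi_i_inv_smul_circleIntegral_sub_inv_smul
      (mem_ball_self hε)
    rw [hψf 0 h0] at key
    simp only [zero_smul, add_zero] at key
    have hI : (∮ ζ in C(0, ε), (ζ - 0)⁻¹ * f (x + ζ • e)) = ∮ ζ in C(0, ε), (ζ - 0)⁻¹ • ψ ζ := by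
      refine circleIntegral.integral_congr hε.le fun ζ hζ => ?_
      have hψζ : ψ ζ = f (x + ζ • e) := hψf ζ (by
        rintro ⟨j, rfl⟩
        rw [mem_sphere_zero_iff_norm, norm_neg] at hζ
        exact hx.2 j hζ)
      simp only [hψζ, smul_eq_mul]
    simp only [G]
    rw [hI, ← smul_eq_mul, key]
  have hGG : ∀ ε > 0, ∀ ε' > 0, ∀ x ∈ N ε, x ∈ N ε' → G ε x = G ε' x := by
    intro ε hε ε' hε' x hx hx'
    refine eq_of_eventually_eq_nhdsWithin (hGd ε hε x hx).continuousAt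
      (hGd ε' hε' x hx').continuousAt (dense_genericSet hs x) ?_
    filter_upwards [self_mem_nhdsWithin, nhdsWithin_le_nhds ((hNo ε).mem_nhds hx),
      nhdsWithin_le_nhds ((hNo ε').mem_nhds hx')] with y hy h1 h2
    rw [hGf ε hε y h1 hy, hGf ε' hε' y h2 hy]
  -- By density of generic points `G ε x` does not depend on `ε`, so a radius chosen pointwise still
  -- gives a holomorphic function.
  choose! ε hε hN using hex
  refine ⟨fun x => G (ε x) x, fun a ha => DifferentiableAt.differentiableWithinAt ?_, fun x hx => ?_⟩
  · refine (hGd _ (hε a ha) a (hN a ha)).congr_of_eventuallyEq ?_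
    filter_upwards [(hNo _).mem_nhds (hN a ha), isOpen_ball.mem_nhds ha] with x hx hxr
    exact hGG _ (hε x hxr) _ (hε a ha) x (hN x hxr) hx
  · have hxr := ballCompl_subset_ball hs r hx
    refine eq_of_eventually_eq_nhdsWithin (hGd _ (hε x hxr) x (hN x hxr)).continuousAt
      (hf.continuousOn.continuousAt ((isOpen_ballCompl hs r).mem_nhds hx))
      (dense_genericSet hs x) ?_
    filter_upwards [self_mem_nhdsWithin, nhdsWithin_le_nhds ((hNo _).mem_nhds (hN x hxr))] with y hy h1
    rw [hGf _ (hε x hxr) y h1 hy]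

end

/-! ### Isolated singularities under power and logarithmic growth bounds. -/

theorem isPreconnected_ball_diff_zero (δ : ℝ) : IsPreconnected (ball (0 : ℂ) δ \ {0}) := by
  have : ball (0 : ℂ) δ \ {0} = Complex.exp '' {z | Real.exp z.re < δ} := by
    ext z
    constructor
    · rintro ⟨hz, hz0⟩
      refine ⟨log z, ?_, exp_log hz0⟩
      rw [mem_ofPred_eq, log_re, Real.exp_log (norm_pos_iff.2 hz0)]
      exact mem_ball_zero_iff.1 hz
    · rintro ⟨w, hw, rfl⟩
      exact ⟨by rwa [mem_ball_zero_iff, norm_exp], exp_ne_zero w⟩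
  rw [this]
  refine IsPreconnected.image (Convex.isPreconnected ?_) _ continuous_exp.continuousOn
  rcases le_or_gt δ 0 with h | h
  · convert convex_empty using 1
    ext z; simpa using h.trans (Real.exp_pos _).le
  · have : {z : ℂ | Real.exp z.re < δ} = {z | z.re < Real.log δ} := by
      ext z; simp [Real.lt_log_iff_exp_lt h]
    rw [this]
    exact convex_halfSpace_re_lt _

theorem tendsto_log_norm_nhdsNE_zero :
    Tendsto (fun ζ : ℂ => Real.log ‖ζ‖) (𝓝[≠] 0) atBot :=
  Real.tendsto_log_nhdsGT_zero.comp tendsto_norm_nhdsNE_zero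

/-- The bound is `e^C |ζ|^(-K)`, and `|ζ|^(1 - K)` tends to `0`. -/
theorem isLittleO_inv_of_norm_le_exp {f : ℂ → ℂ} {C K : ℝ} (hK : K < 1)
    (hb : ∀ᶠ ζ in 𝓝[≠] (0 : ℂ), ‖f ζ‖ ≤ Real.exp (C - K * Real.log ‖ζ‖)) :
    f =o[𝓝[≠] 0] fun ζ => ζ⁻¹ := by
  refine (Asymptotics.isLittleO_iff_tendsto' ?_).2 ?_
  · filter_upwards [self_mem_nhdsWithin] with ζ hζ h using absurd (inv_eq_zero.1 h) hζ
  · rw [tendsto_zero_iff_norm_tendsto_zero]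
    have h1 : Tendsto (fun ζ : ℂ => Real.exp (C + (1 - K) * Real.log ‖ζ‖)) (𝓝[≠] 0) (𝓝 0) := by
      refine Real.tendsto_exp_atBot.comp (tendsto_atBot_add_const_left _ _ ?_)
      exact tendsto_log_norm_nhdsNE_zero.const_mul_atBot (by linarith)
    refine squeeze_zero' (Eventually.of_forall fun _ => norm_nonneg _) ?_ h1
    filter_upwards [hb, self_mem_nhdsWithin] with ζ h hζ
    have h0 : 0 < ‖ζ‖ := norm_pos_iff.2 hζ
    rw [norm_div, norm_inv, div_inv_eq_mul]
    calc ‖f ζ‖ * ‖ζ‖ ≤ Real.exp (C - K * Real.log ‖ζ‖) * Real.exp (Real.log ‖ζ‖) := by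
          rw [Real.exp_log h0]; gcongr
      _ = _ := by rw [← Real.exp_add]; ring_nf

theorem isLittleO_inv_of_norm_le {f : ℂ → ℂ} {M : ℝ} (hb : ∀ᶠ ζ in 𝓝[≠] (0 : ℂ), ‖f ζ‖ ≤ M) :
    f =o[𝓝[≠] 0] fun ζ => ζ⁻¹ := by
  refine isLittleO_inv_of_norm_le_exp (C := Real.log (|M| + 1)) (K := 0) one_pos ?_
  filter_upwards [hb] with ζ h
  rw [zero_mul, sub_zero, Real.exp_log (by positivity)]
  linarith [le_abs_self M]

theorem exists_analyticAt_of_isLittleO_inv {f : ℂ → ℂ}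
    (hf : ∀ᶠ ζ in 𝓝[≠] (0 : ℂ), DifferentiableAt ℂ f ζ) (ho : f =o[𝓝[≠] 0] fun ζ => ζ⁻¹) :
    ∃ F : ℂ → ℂ, AnalyticAt ℂ F 0 ∧ ∀ ζ ≠ 0, F ζ = f ζ := by
  obtain ⟨δ, hδ, hball⟩ := Metric.eventually_nhds_iff_ball.1 (eventually_nhdsWithin_iff.1 hf)
  obtain ⟨F, hF, hFf⟩ := exists_differentiableOn_of_isLittleO_finite (U := ball (0 : ℂ) δ) isOpen_ball
    (finite_singleton 0) (fun ζ hζ => (hball ζ hζ.1 hζ.2).differentiableWithinAt) (by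
      rintro c ⟨rfl, _⟩; simpa using ho)
  exact ⟨F, hF.analyticAt (ball_mem_nhds 0 hδ), fun ζ hζ => hFf ζ hζ⟩

/-- A holomorphic function on a punctured disc whose real part has at most a logarithmic upper
bound is bounded near the puncture. -/
theorem exists_norm_le_of_re_le_log {w : ℂ → ℂ}
    (hw : ∀ᶠ ζ in 𝓝[≠] (0 : ℂ), DifferentiableAt ℂ w ζ) {C K : ℝ}
    (hb : ∀ᶠ ζ in 𝓝[≠] (0 : ℂ), (w ζ).re ≤ C - K * Real.log ‖ζ‖) :
    ∃ M, ∀ᶠ ζ in 𝓝[≠] (0 : ℂ), ‖w ζ‖ ≤ M := by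
  -- Although `w` itself could a priori be essentially singular, `exp (t w)` is `O(|ζ|^(-tK))`,
  -- which is removable for small `t`.
  have hext : ∀ t : ℝ, 0 < t → t * K < 1 →
      ∃ F : ℂ → ℂ, AnalyticAt ℂ F 0 ∧ ∀ ζ ≠ 0, F ζ = exp (t * w ζ) := by
    intro t ht htK
    refine exists_analyticAt_of_isLittleO_inv ?_ (isLittleO_inv_of_norm_le_exp (C := t * C) htK ?_)
    · filter_upwards [hw] with ζ h using (h.const_mul _).cexp
    · filter_upwards [hb] with ζ h
      rw [norm_exp, re_ofReal_mul, Real.exp_le_exp]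
      nlinarith
  set t : ℝ := 1 / (|K| + 1)
  have ht : 0 < t := by positivity
  have htk : ∀ k : ℕ, t / (k + 1) * K < 1 := fun k => by
    have h1 : t * |K| < 1 := by
      rw [div_mul_eq_mul_div, div_lt_one (by positivity)]; linarith
    have h2 : t / (k + 1) ≤ t := div_le_self ht.le (by linarith [(Nat.cast_nonneg k : (0 : ℝ) ≤ k)])
    have h3 : 0 < t / (k + 1) := by positivity
    nlinarith [le_abs_self K, abs_nonneg K]
  obtain ⟨F, hF, hFw⟩ := hext t ht (by simpa using htk 0)
  have hFne : ∀ ζ ≠ 0, F ζ ≠ 0 := fun ζ hζ => by rw [hFw ζ hζ]; exact exp_ne_zero _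
  have hne : ∀ᶠ ζ in 𝓝[≠] (0 : ℂ), F ζ ≠ 0 := by
    filter_upwards [self_mem_nhdsWithin] with ζ hζ using hFne ζ hζ
  -- If `F` vanishes to order `m`, then `F = F' ^ (m + 1)` with `F' = exp (t w / (m + 1))`, so `m +
  -- 1` divides `m` and `m = 0`.
  have hF0 : F 0 ≠ 0 := by
    rw [← hF.analyticOrderAt_eq_zero]
    have hfin : analyticOrderAt F 0 ≠ ⊤ := fun h => by
      have := (analyticOrderAt_eq_top.1 h).filter_mono (nhdsWithin_le_nhds (s := {0}ᶜ))
      obtain ⟨ζ, h1, h2⟩ := (this.and hne).exists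
      exact h2 h1
    obtain ⟨m, hm⟩ := ENat.ne_top_iff_exists.1 hfin
    obtain ⟨F', hF', hFw'⟩ := hext (t / (m + 1)) (by positivity) (htk m)
    have hpow : F =ᶠ[𝓝 0] F' ^ (m + 1) := by
      refine (hF.frequently_eq_iff_eventually_eq (hF'.pow (m + 1))).1 (Eventually.frequently ?_)
      filter_upwards [self_mem_nhdsWithin] with ζ hζ
      rw [Pi.pow_apply, hFw ζ hζ, hFw' ζ hζ, ← exp_nat_mul]
      congr 1
      push_cast
      have : (m : ℂ) + 1 ≠ 0 := Nat.cast_add_one_ne_zero m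
      field_simp
    rw [analyticOrderAt_congr hpow, analyticOrderAt_pow hF'] at hm ⊢
    have hfin' : analyticOrderAt F' 0 ≠ ⊤ := fun h => by
      rw [h, nsmul_eq_mul, ENat.mul_top (by simp)] at hm
      exact absurd hm (ENat.natCast_ne_top m)
    obtain ⟨m', hm'⟩ := ENat.ne_top_iff_exists.1 hfin'
    rw [← hm', nsmul_eq_mul] at hm ⊢
    norm_cast at hm ⊢
    rcases Nat.eq_zero_or_pos m' with h | h
    · simp [h]
    · nlinarith
  have hw' := eventually_nhdsWithin_iff.1 hw
  obtain ⟨δ, hδ, hball⟩ := Metric.eventually_nhds_iff_ball.1 (hF.eventually_analyticAt.and hw')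
  have hFne' : ∀ ζ, F ζ ≠ 0 := fun ζ => by
    rcases eq_or_ne ζ 0 with rfl | h
    exacts [hF0, hFne ζ h]
  have hFd : DifferentiableOn ℂ F (ball 0 δ) := fun ζ hζ =>
    (hball ζ hζ).1.differentiableAt.differentiableWithinAt
  -- Off `0` this is the derivative of `w`; it is holomorphic at `0` too, and its primitive differs
  -- from `w` by a constant on the connected punctured disc.
  have hψ : DifferentiableOn ℂ (fun ζ => (t : ℂ)⁻¹ * (deriv F ζ / F ζ)) (ball 0 δ) :=
    ((hFd.deriv isOpen_ball).div hFd fun ζ _ => hFne' ζ).const_mul _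
  obtain ⟨Ω, hΩ⟩ := hψ.isExactOn_ball
  have ht0 : (t : ℂ) ≠ 0 := by exact_mod_cast ht.ne'
  have hder : ∀ ζ ∈ ball (0 : ℂ) δ \ {0}, HasDerivAt (fun ζ => w ζ - Ω ζ) 0 ζ := by
    rintro ζ ⟨hζ, hζ0⟩
    have h1 := ((hball ζ hζ).2 hζ0).hasDerivAt
    have h2 : HasDerivAt F (exp (t * w ζ) * (t * deriv w ζ)) ζ :=
      ((h1.const_mul (t : ℂ)).cexp).congr_of_eventuallyEq (by
        filter_upwards [isOpen_ne.mem_nhds hζ0] with z hz using hFw z hz)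
    have h3 : HasDerivAt (fun ζ => w ζ - Ω ζ) (deriv w ζ - (t : ℂ)⁻¹ * (deriv F ζ / F ζ)) ζ :=
      h1.sub (hΩ ζ hζ)
    rw [h2.deriv, ← hFw ζ hζ0] at h3
    have h4 : deriv w ζ - (t : ℂ)⁻¹ * (F ζ * (t * deriv w ζ) / F ζ) = 0 := by
      have := hFne' ζ
      field_simp
      ring
    rwa [h4] at h3
  have hopen : IsOpen (ball (0 : ℂ) δ \ {0}) := isOpen_ball.sdiff isClosed_singleton
  obtain ⟨c, hc⟩ := hopen.exists_is_const_of_deriv_eq_zero (isPreconnected_ball_diff_zero δ)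
    (fun ζ hζ => (hder ζ hζ).differentiableAt.differentiableWithinAt)
    (fun ζ hζ => (hder ζ hζ).deriv)
  have hΩc : ContinuousAt Ω 0 := (hΩ 0 (mem_ball_self hδ)).continuousAt
  refine ⟨‖c‖ + (‖Ω 0‖ + 1), ?_⟩
  filter_upwards [self_mem_nhdsWithin, nhdsWithin_le_nhds (ball_mem_nhds (0 : ℂ) hδ),
    nhdsWithin_le_nhds (hΩc.norm.eventually (gt_mem_nhds (lt_add_one ‖Ω 0‖)))] with ζ h1 h2 h3
  have := hc ζ ⟨h2, h1⟩
  rw [sub_eq_iff_eq_add.1 this]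
  exact (norm_add_le _ _).trans (by linarith)

/-! ### Exponential coordinates -/

/-- The exponential in the first `s` coordinates. -/
noncomputable def expCoord {n : ℕ} (s : ℕ) (z : Cn n) : Cn n :=
  WithLp.toLp 2 fun i => if (i : ℕ) < s then exp (z i) else z i

/-- The preimage of the ball under `expCoord`: a convex model of the universal covering. -/
def logDomain (n s : ℕ) (r : ℝ) : Set (Cn n) := {z | expCoord s z ∈ ball 0 r}

/-- The translation of the lattice `2πiℤˢ` by the vector `k`. -/
noncomputable def latticeShift {n s : ℕ} (k : Fin s → ℤ) : Cn n :=
  WithLp.toLp 2 fun i => if h : (i : ℕ) < s then (k ⟨i, h⟩ : ℂ) * (2 * Real.pi * I) else 0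

section

variable {n s : ℕ} (hs : s ≤ n) {r : ℝ}

theorem expCoord_apply_castLE (z : Cn n) (j : Fin s) :
    expCoord s z (Fin.castLE hs j) = exp (z (Fin.castLE hs j)) := by
  simp [expCoord]

theorem latticeShift_apply_castLE (k : Fin s → ℤ) (j : Fin s) :
    (latticeShift k : Cn n) (Fin.castLE hs j) = k j * (2 * Real.pi * I) := by
  simp [latticeShift]

theorem latticeShift_zero : (latticeShift (0 : Fin s → ℤ) : Cn n) = 0 := by
  ext i; simp [latticeShift]

theorem latticeShift_add (k l : Fin s → ℤ) :
    (latticeShift (k + l) : Cn n) = latticeShift k + latticeShift l := by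
  ext i; by_cases h : (i : ℕ) < s <;> simp [latticeShift, h, add_mul]

theorem expCoord_add_latticeShift (z : Cn n) (k : Fin s → ℤ) :
    expCoord s (z + latticeShift k) = expCoord s z := by
  ext i
  by_cases h : (i : ℕ) < s
  · simp [expCoord, latticeShift, h, exp_add, exp_int_mul_two_pi_mul_I]
  · simp [expCoord, latticeShift, h]

theorem expCoord_eq_iff {z w : Cn n} :
    expCoord s w = expCoord s z ↔ ∃ k : Fin s → ℤ, w = z + latticeShift k := by
  constructor
  · intro h
    have h1 : ∀ j : Fin n, ∃ m : ℤ, (j : ℕ) < s → w j = z j + m * (2 * Real.pi * I) := by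
      intro j
      by_cases hj : (j : ℕ) < s
      · have := congrArg (fun x : Cn n => x j) h
        simp only [expCoord, hj, if_true] at this
        obtain ⟨m, hm⟩ := exp_eq_exp_iff_exists_int.1 this
        exact ⟨m, fun _ => hm⟩
      · exact ⟨0, fun h => absurd h hj⟩
    choose m hm using h1
    by_cases hsn : s ≤ n
    · refine ⟨fun j => m (Fin.castLE hsn j), ?_⟩
      ext i
      by_cases hi : (i : ℕ) < s
      · simp [latticeShift, hi, hm i hi]
      · have := congrArg (fun x : Cn n => x i) h
        simpa [expCoord, latticeShift, hi] using this
    -- For `s > n` the entries of the lattice vector beyond `n` are never read by `latticeShift`.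
    · refine ⟨fun j => if h : (j : ℕ) < n then m ⟨j, h⟩ else 0, ?_⟩
      ext i
      have hi : (i : ℕ) < s := by omega
      simp [latticeShift, hi, hm i hi]
  · rintro ⟨k, rfl⟩
    exact expCoord_add_latticeShift z k

theorem differentiable_expCoord : Differentiable ℂ (expCoord s : Cn n → Cn n) := by
  rw [differentiable_euclidean]
  intro i
  by_cases h : (i : ℕ) < s
  · simp only [expCoord, h, if_true]; fun_prop
  · simp only [expCoord, h, if_false]; fun_prop

theorem isOpen_logDomain : IsOpen (logDomain n s r) :=
  isOpen_ball.preimage differentiable_expCoord.continuous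

/-- The squared norm of `expCoord s z` is a sum of terms `exp (2 Re z_i)` and `|z_i|²`, all convex;
the domain is a sublevel set. -/
theorem convex_logDomain : Convex ℝ (logDomain n s r) := by
  rcases le_or_gt r 0 with hr | hr
  · have : logDomain n s r = ∅ := by
      ext z; simp [logDomain, ball_eq_empty.2 hr]
    rw [this]; exact convex_empty
  have hset : logDomain n s r =
      {z ∈ univ | (∑ i : Fin n, if (i : ℕ) < s then Real.exp (2 * (z i).re) else ‖z i‖ ^ 2) < r ^ 2} := by
    ext z
    simp only [logDomain, mem_ofPred_eq, mem_univ, true_and]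
    rw [mem_ball_zero_iff, ← sq_lt_sq₀ (norm_nonneg _) hr.le, EuclideanSpace.norm_sq_eq]
    refine iff_of_eq (congrArg (· < r ^ 2) (Finset.sum_congr rfl fun i _ => ?_))
    by_cases h : (i : ℕ) < s
    · simp only [expCoord, h, if_true, norm_exp, ← Real.exp_nat_mul]; norm_num
    · simp only [expCoord, h, if_false]
  rw [hset]
  have hterm : ∀ i : Fin n, ConvexOn ℝ univ
      fun z : Cn n => if (i : ℕ) < s then Real.exp (2 * (z i).re) else ‖z i‖ ^ 2 := by
    intro i
    by_cases h : (i : ℕ) < s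
    · simp only [h, if_true]
      exact convexOn_exp.comp_linearMap
        ({ toFun := fun z => 2 * (z i).re
           map_add' := fun z w => by simp [mul_add]
           map_smul' := fun a z => by simp [mul_left_comm] } : Cn n →ₗ[ℝ] ℝ)
    · simp only [h, if_false]
      exact (convexOn_univ_norm.comp_linearMap
        ({ toFun := fun z => z i
           map_add' := fun z w => rfl
           map_smul' := fun a z => rfl } : Cn n →ₗ[ℝ] ℂ)).pow (fun z _ => norm_nonneg _) 2
  refine ConvexOn.convex_lt ⟨convex_univ, fun z hz w hw a b ha hb hab => ?_⟩ _
  simp only [smul_eq_mul, Finset.mul_sum, ← Finset.sum_add_distrib]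
  exact Finset.sum_le_sum fun i _ => (hterm i).2 hz hw ha hb hab

theorem add_latticeShift_mem {z : Cn n} (hz : z ∈ logDomain n s r) (k : Fin s → ℤ) :
    z + latticeShift k ∈ logDomain n s r := by
  rwa [logDomain, mem_ofPred_eq, expCoord_add_latticeShift]

theorem expCoord_mem_ballCompl {z : Cn n} (hz : z ∈ logDomain n s r) :
    expCoord s z ∈ ballCompl n s hs r :=
  ⟨hz, fun j => by rw [expCoord_apply_castLE]; exact exp_ne_zero _⟩

/-- The local inverse of `expCoord` around `z₀`. -/
noncomputable def logCoord (s : ℕ) (z₀ x : Cn n) : Cn n :=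
  WithLp.toLp 2 fun i => if (i : ℕ) < s then z₀ i + log (x i * exp (-z₀ i)) else x i

theorem expCoord_logCoord (z₀ : Cn n) {x : Cn n} (hx : ∀ j : Fin s, x (Fin.castLE hs j) ≠ 0) :
    expCoord s (logCoord s z₀ x) = x := by
  ext i
  by_cases h : (i : ℕ) < s
  · have hxi : x i ≠ 0 := hx ⟨i, h⟩
    simp only [expCoord, logCoord, h, if_true]
    rw [exp_add, exp_log (mul_ne_zero hxi (exp_ne_zero _)), mul_left_comm, ← exp_add]
    simp
  · simp [expCoord, logCoord, h]

/-- The principal logarithm inverts `exp` as long as the imaginary parts of `z - z₀` stay in `(-π,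
π)`. -/
theorem logCoord_expCoord_eventuallyEq (z₀ : Cn n) :
    ∀ᶠ z in 𝓝 z₀, logCoord s z₀ (expCoord s z) = z := by
  have h : ∀ᶠ z in 𝓝 z₀, ∀ i, |(z i - z₀ i).im| < Real.pi := by
    refine eventually_all.2 fun i => ?_
    have : Continuous fun z : Cn n => |(z i - z₀ i).im| := by fun_prop
    exact (this.tendsto' z₀ 0 (by simp)).eventually (gt_mem_nhds Real.pi_pos)
  filter_upwards [h] with z hz
  ext i
  by_cases h : (i : ℕ) < s
  · simp only [expCoord, logCoord, h, if_true]
    rw [← exp_add, ← sub_eq_add_neg, log_exp (abs_lt.1 (hz i)).1 (abs_lt.1 (hz i)).2.le]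
    ring
  · simp [expCoord, logCoord, h]

theorem exists_logCoord_nhds {z₀ : Cn n} (hz₀ : z₀ ∈ logDomain n s r) :
    ∃ U : Set (Cn n), IsOpen U ∧ expCoord s z₀ ∈ U ∧ U ⊆ ballCompl n s hs r ∧
      DifferentiableOn ℂ (logCoord s z₀) U ∧ MapsTo (logCoord s z₀) U (logDomain n s r) := by
  refine ⟨ballCompl n s hs r ∩
      ⋂ j : Fin s, {x | x (Fin.castLE hs j) * exp (-z₀ (Fin.castLE hs j)) ∈ slitPlane},
    (isOpen_ballCompl hs r).inter (isOpen_iInter_of_finite fun j =>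
      isOpen_slitPlane.preimage (by fun_prop)), ⟨expCoord_mem_ballCompl hs hz₀, ?_⟩,
      inter_subset_left, ?_, ?_⟩
  · refine mem_iInter.2 fun j => ?_
    simp [expCoord_apply_castLE, ← exp_add]
  · intro x hx
    refine DifferentiableAt.differentiableWithinAt (differentiableAt_euclidean.2 fun i => ?_)
    by_cases h : (i : ℕ) < s
    · simp only [logCoord, h, if_true]
      have := mem_iInter.1 hx.2 ⟨i, h⟩
      refine DifferentiableAt.const_add _ (DifferentiableAt.clog (by fun_prop) this)
    · simp only [logCoord, h, if_false]; fun_prop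
  · intro x hx
    rw [logDomain, mem_ofPred_eq, expCoord_logCoord hs z₀ hx.1.2]
    exact hx.1.1

theorem exists_expCoord_eq {x : Cn n} (hx : x ∈ ballCompl n s hs r) :
    ∃ z ∈ logDomain n s r, expCoord s z = x := by
  have h := expCoord_logCoord hs 0 hx.2
  exact ⟨logCoord s 0 x, by rw [logDomain, mem_ofPred_eq, h]; exact hx.1, h⟩

theorem logDomain_nonempty (hr : 0 < r) (hs : s ≤ n) : (logDomain n s r).Nonempty := by
  have := nhdsWithin_ballCompl_neBot hs (mem_ball_self hr (x := (0 : Cn n)))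
  obtain ⟨x, hx⟩ := Filter.nonempty_of_mem (self_mem_nhdsWithin (a := (0 : Cn n)) (s := ballCompl n s hs r))
  obtain ⟨z, hz, -⟩ := exists_expCoord_eq hs hx
  exact ⟨z, hz⟩

/-- Functions on `logDomain` invariant under the generators of the lattice descend. -/
theorem exists_descent {G : Cn n → ℂ} (hG : DifferentiableOn ℂ G (logDomain n s r))
    (hper : ∀ j : Fin s, ∀ z ∈ logDomain n s r, G (z + latticeShift (Pi.single j 1)) = G z) :
    ∃ g : Cn n → ℂ, DifferentiableOn ℂ g (ballCompl n s hs r) ∧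
      ∀ z ∈ logDomain n s r, g (expCoord s z) = G z := by
  -- Periods form a subgroup, so periodicity under the generators gives it for the whole lattice.
  let P : AddSubgroup (Fin s → ℤ) :=
    { carrier := {k | ∀ z ∈ logDomain n s r, G (z + latticeShift k) = G z}
      zero_mem' := fun z _ => by rw [latticeShift_zero, add_zero]
      add_mem' := fun {k l} hk hl z hz => by
        rw [latticeShift_add, ← add_assoc, hl _ (add_latticeShift_mem hz k), hk z hz]
      neg_mem' := fun {k} hk z hz => by
        have := hk _ (add_latticeShift_mem hz (-k))
        rw [add_assoc, ← latticeShift_add, neg_add_cancel, latticeShift_zero, add_zero] at this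
        exact this.symm }
  have hP : ∀ k, k ∈ P := fun k => by
    have : k = ∑ j, k j • (Pi.single j (1 : ℤ) : Fin s → ℤ) := by
      ext i; simp [Finset.sum_apply, Pi.single_apply]
    rw [this]
    exact P.sum_mem fun j _ => P.zsmul_mem (hper j) _
  choose! L hL hLx using fun (x : Cn n) (hx : x ∈ ballCompl n s hs r) => exists_expCoord_eq hs hx
  have key : ∀ z ∈ logDomain n s r, G (L (expCoord s z)) = G z := by
    intro z hz
    obtain ⟨k, hk⟩ := expCoord_eq_iff.1 (hLx _ (expCoord_mem_ballCompl hs hz))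
    rw [hk]; exact hP k z hz
  -- `L` is chosen without any continuity; by periodicity `G ∘ L` coincides near each point with `G`
  -- composed with the holomorphic branch `logCoord`.
  refine ⟨fun x => G (L x), fun x hx => DifferentiableAt.differentiableWithinAt ?_, key⟩
  obtain ⟨z₀, hz₀, rfl⟩ := exists_expCoord_eq hs hx
  obtain ⟨U, hU, hxU, hUX, hd, hmaps⟩ := exists_logCoord_nhds hs hz₀
  refine ((hG.comp hd hmaps).differentiableAt (hU.mem_nhds hxU)).congr_of_eventuallyEq ?_
  filter_upwards [hU.mem_nhds hxU] with y hy
  have := key _ (hmaps hy)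
  rwa [expCoord_logCoord hs z₀ (hUX hy).2] at this

/-! ### Behaviour along lines transverse to one hyperplane -/

theorem eventually_add_smul_mem_ballCompl {y : Cn n} (hy : y ∈ ball (0 : Cn n) r) {j : Fin s}
    (hj : y (Fin.castLE hs j) = 0) (hk : ∀ k ≠ j, y (Fin.castLE hs k) ≠ 0) :
    ∀ᶠ ζ : ℂ in 𝓝[≠] 0, y + ζ • onesVec n ∈ ballCompl n s hs r := by
  have h1 : ∀ᶠ ζ : ℂ in 𝓝[≠] 0, y + ζ • onesVec n ∈ ball (0 : Cn n) r :=
    (((by fun_prop : Continuous fun ζ : ℂ => y + ζ • onesVec n).tendsto' 0 y (by simp)).eventually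
      (isOpen_ball.mem_nhds hy)).filter_mono nhdsWithin_le_nhds
  have h2 : ∀ᶠ ζ : ℂ in 𝓝[≠] 0, ∀ k : Fin s, (y + ζ • onesVec n) (Fin.castLE hs k) ≠ 0 := by
    refine eventually_all.2 fun k => ?_
    rcases eq_or_ne k j with rfl | hkj
    · filter_upwards [self_mem_nhdsWithin] with ζ hζ
      simpa [hj] using hζ
    · refine Eventually.filter_mono nhdsWithin_le_nhds ?_
      refine ((by fun_prop : Continuous fun ζ : ℂ =>
        (y + ζ • onesVec n) (Fin.castLE hs k)).tendsto' 0 (y (Fin.castLE hs k)) (by simp)).eventually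
        (isOpen_ne.mem_nhds (hk k hkj))
  filter_upwards [h1, h2] with ζ h1 h2 using ⟨h1, h2⟩

/-- Along this line only the `j`-th logarithm is unbounded; the other terms converge and go into
`C`. -/
theorem exists_sum_log_le (c : Fin s → ℝ) {y : Cn n} {j : Fin s}
    (hj : y (Fin.castLE hs j) = 0) (hk : ∀ k ≠ j, y (Fin.castLE hs k) ≠ 0) :
    ∃ C, ∀ᶠ ζ : ℂ in 𝓝[≠] 0,
      -∑ k, c k * Real.log ‖(y + ζ • onesVec n) (Fin.castLE hs k)‖ ≤ C - c j * Real.log ‖ζ‖ := by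
  classical
  have ht : Tendsto (fun ζ : ℂ => -∑ k ∈ Finset.univ.erase j,
      c k * Real.log ‖(y + ζ • onesVec n) (Fin.castLE hs k)‖) (𝓝 0)
      (𝓝 (-∑ k ∈ Finset.univ.erase j, c k * Real.log ‖y (Fin.castLE hs k)‖)) := by
    refine (tendsto_finsetSum _ fun k hkj => ?_).neg
    refine Tendsto.const_mul _ (Tendsto.log ?_ (norm_ne_zero_iff.2 (hk k (Finset.ne_of_mem_erase hkj))))
    exact (by fun_prop : Continuous fun ζ : ℂ => ‖(y + ζ • onesVec n) (Fin.castLE hs k)‖).tendsto' 0 _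
      (by simp)
  refine ⟨-∑ k ∈ Finset.univ.erase j, c k * Real.log ‖y (Fin.castLE hs k)‖ + 1, ?_⟩
  filter_upwards [(ht.eventually (gt_mem_nhds (lt_add_one _))).filter_mono nhdsWithin_le_nhds] with ζ hζ
  rw [← Finset.add_sum_erase _ _ (Finset.mem_univ j)]
  have : (y + ζ • onesVec n) (Fin.castLE hs j) = ζ := by simp [hj]
  rw [this]
  linarith

theorem exists_mem_ball_unique_zero (hr : 0 < r) (j : Fin s) : ∃ y ∈ ball (0 : Cn n) r,
    y (Fin.castLE hs j) = 0 ∧ ∀ k ≠ j, y (Fin.castLE hs k) ≠ 0 := by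
  set v : Cn n := onesVec n - EuclideanSpace.single (Fin.castLE hs j) 1
  refine ⟨((r / 2 / (‖v‖ + 1) : ℝ) : ℂ) • v, ?_, by simp [v], fun k hk => ?_⟩
  · rw [mem_ball_zero_iff, norm_smul, norm_real, Real.norm_of_nonneg (by positivity),
      div_mul_eq_mul_div, div_lt_iff₀ (by positivity)]
    nlinarith [norm_nonneg v]
  · have h1 : (r / 2 / (‖v‖ + 1) : ℝ) ≠ 0 := by positivity
    have h2 : v (Fin.castLE hs k) = 1 := by
      simp [v, (Fin.castLE_injective hs).ne hk]
    rw [PiLp.smul_apply, h2, smul_eq_mul, mul_one]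
    exact ofReal_ne_zero.2 h1

end

/-! ### Extension theorems for translation, rotation and homothety monodromy. -/

section

variable {n s : ℕ} (hs : s ≤ n) {r : ℝ}

theorem log_norm_expCoord (z : Cn n) (j : Fin s) :
    Real.log ‖expCoord s z (Fin.castLE hs j)‖ = (z (Fin.castLE hs j)).re := by
  rw [expCoord_apply_castLE, norm_exp, Real.log_exp]

theorem sum_mul_add_latticeShift_single (c : Fin s → ℂ) (z : Cn n) (j : Fin s) :
    ∑ i, c i * (z + latticeShift (Pi.single j 1) : Cn n) (Fin.castLE hs i) =
      ∑ i, c i * z (Fin.castLE hs i) + c j * (2 * Real.pi * I) := by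
  simp only [PiLp.add_apply, latticeShift_apply_castLE, mul_add, Finset.sum_add_distrib]
  congr 1
  rw [Finset.sum_eq_single j] <;> simp +contextual

theorem differentiable_sum_mul (c : Fin s → ℂ) :
    Differentiable ℂ fun z : Cn n => ∑ i, c i * z (Fin.castLE hs i) := by
  fun_prop

theorem slice_differentiableAt {f : Cn n → ℂ} (hf : DifferentiableOn ℂ f (ballCompl n s hs r))
    {y : Cn n} {ζ : ℂ} (h : y + ζ • onesVec n ∈ ballCompl n s hs r) :
    DifferentiableAt ℂ (fun ζ : ℂ => f (y + ζ • onesVec n)) ζ :=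
  DifferentiableAt.comp (f := fun ζ : ℂ => y + ζ • onesVec n) ζ
    (hf.differentiableAt ((isOpen_ballCompl hs r).mem_nhds h)) (by fun_prop)

/-- Removing `1/(2πi) ∑ a_i z_i` kills the periods, leaving a function `g₀` of `x`. Since `Im G ≥
0`, the real part of `i g₀` is at most `-∑ (a_k / 2π) log |x_k|`, so `g₀` is bounded on transverse
slices. If `a_j < 0`, that upper bound tends to `-∞`, which is incompatible with boundedness. -/
theorem parabolic_extension (hr : 0 < r) {G : Cn n → ℂ} (hG : DifferentiableOn ℂ G (logDomain n s r))
    (him : ∀ z ∈ logDomain n s r, 0 ≤ (G z).im) (a : Fin s → ℝ)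
    (hshift : ∀ j : Fin s, ∀ z ∈ logDomain n s r, G (z + latticeShift (Pi.single j 1)) = G z + a j) :
    (∀ j, 0 ≤ a j) ∧ ∃ g : Cn n → ℂ, DifferentiableOn ℂ g (ball 0 r) ∧
      ∀ z ∈ logDomain n s r,
        G z = 1 / (2 * Real.pi * I) * ∑ i, (a i : ℂ) * z (Fin.castLE hs i) + g (expCoord s z) := by
  have hpi : (2 * Real.pi * I : ℂ) ≠ 0 := two_pi_I_ne_zero
  obtain ⟨g₀, hg₀, hg₀G⟩ := exists_descent hs
    (G := fun z => G z - 1 / (2 * Real.pi * I) * ∑ i, (a i : ℂ) * z (Fin.castLE hs i))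
    (hG.sub ((differentiable_sum_mul hs _).const_mul _).differentiableOn) (fun j z hz => by
      rw [hshift j z hz, sum_mul_add_latticeShift_single]
      field_simp
      ring)
  have hbound : ∀ x ∈ ballCompl n s hs r, (I * g₀ x).re ≤
      -∑ k, a k / (2 * Real.pi) * Real.log ‖x (Fin.castLE hs k)‖ := by
    intro x hx
    obtain ⟨z, hz, rfl⟩ := exists_expCoord_eq hs hx
    have h1 : (1 / (2 * Real.pi * I) * ∑ i, (a i : ℂ) * z (Fin.castLE hs i)).im =
        -∑ k, a k / (2 * Real.pi) * (z (Fin.castLE hs k)).re := by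
      have : (1 / (2 * Real.pi * I) : ℂ) = ((1 / (2 * Real.pi) : ℝ) : ℂ) * -I := by
        push_cast
        have := Real.pi_ne_zero
        field_simp
        simp
      rw [this, mul_assoc, im_ofReal_mul, Finset.mul_sum, im_sum, Finset.mul_sum,
        ← Finset.sum_neg_distrib]
      refine Finset.sum_congr rfl fun k _ => ?_
      simp
      ring
    simp only [log_norm_expCoord]
    rw [hg₀G z hz, I_mul_re, sub_im, h1]
    linarith [him z hz]
  have hslice : ∀ y ∈ ball (0 : Cn n) r, ∀ j : Fin s, y (Fin.castLE hs j) = 0 →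
      (∀ k ≠ j, y (Fin.castLE hs k) ≠ 0) →
      (∃ M, ∀ᶠ ζ : ℂ in 𝓝[≠] 0, ‖I * g₀ (y + ζ • onesVec n)‖ ≤ M) ∧ 0 ≤ a j := by
    intro y hy j hj hk
    have hmem := eventually_add_smul_mem_ballCompl hs hy hj hk
    obtain ⟨C, hC⟩ := exists_sum_log_le hs (fun k => a k / (2 * Real.pi)) hj hk
    have hle : ∀ᶠ ζ : ℂ in 𝓝[≠] 0, (I * g₀ (y + ζ • onesVec n)).re ≤
        C - a j / (2 * Real.pi) * Real.log ‖ζ‖ := by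
      filter_upwards [hmem, hC] with ζ h1 h2 using (hbound _ h1).trans h2
    obtain ⟨M, hM⟩ := exists_norm_le_of_re_le_log
      (w := fun ζ => I * g₀ (y + ζ • onesVec n))
      (by filter_upwards [hmem] with ζ h using (slice_differentiableAt hs hg₀ h).const_mul _) hle
    refine ⟨⟨M, hM⟩, le_of_not_gt fun hneg => ?_⟩
    have ht : Tendsto (fun ζ : ℂ => C - a j / (2 * Real.pi) * Real.log ‖ζ‖) (𝓝[≠] 0) atBot := by
      have h1 : 0 < -(a j / (2 * Real.pi)) := by
        rw [← neg_div]; exact div_pos (by linarith) (by positivity)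
      refine (tendsto_atBot_add_const_left _ C
        (tendsto_log_norm_nhdsNE_zero.const_mul_atBot h1)).congr fun ζ => by ring
    obtain ⟨ζ, ⟨h1, h2⟩, h3⟩ := ((hM.and hle).and (ht.eventually (eventually_lt_atBot (-M)))).exists
    have := (abs_le.1 ((abs_re_le_norm _).trans h1)).1
    linarith
  obtain ⟨g, hg, hgg⟩ := exists_differentiableOn_ball_extension hs hg₀ fun y hy j hj hk => by
    obtain ⟨⟨M, hM⟩, -⟩ := hslice y hy j hj hk
    refine isLittleO_inv_of_norm_le (M := M) ?_
    filter_upwards [hM] with ζ h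
    simpa using h
  refine ⟨fun j => ?_, g, hg, fun z hz => ?_⟩
  · obtain ⟨y, hy, hj, hk⟩ := exists_mem_ball_unique_zero hs hr j
    exact (hslice y hy j hj hk).2
  · rw [hgg _ (expCoord_mem_ballCompl hs hz), hg₀G z hz]
    ring

/-- The single-valued quotient is bounded by `∏ |x_k|^(-ν_k)`, and `ν_j < 1` makes this `o(1/|x_j|)`
near a general point of the `j`-th hyperplane. -/
theorem elliptic_extension {G : Cn n → ℂ} (hG : DifferentiableOn ℂ G (logDomain n s r))
    (hle : ∀ z ∈ logDomain n s r, ‖G z‖ ≤ 1) (ν : Fin s → ℝ) (hν : ∀ j, ν j < 1)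
    (hshift : ∀ j : Fin s, ∀ z ∈ logDomain n s r,
      G (z + latticeShift (Pi.single j 1)) = exp (ν j * (2 * Real.pi * I)) * G z) :
    ∃ u : Cn n → ℂ, DifferentiableOn ℂ u (ball 0 r) ∧
      ∀ z ∈ logDomain n s r,
        G z = u (expCoord s z) * exp (∑ i, (ν i : ℂ) * z (Fin.castLE hs i)) := by
  obtain ⟨u₀, hu₀, hu₀G⟩ := exists_descent hs
    (G := fun z => G z * exp (-∑ i, (ν i : ℂ) * z (Fin.castLE hs i)))
    (hG.mul (differentiable_sum_mul hs _).neg.cexp.differentiableOn) (fun j z hz => by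
      rw [hshift j z hz, sum_mul_add_latticeShift_single, neg_add, exp_add, exp_neg (_ * _)]
      have := exp_ne_zero ((ν j : ℂ) * (2 * Real.pi * I))
      field_simp)
  have hbound : ∀ x ∈ ballCompl n s hs r, ‖u₀ x‖ ≤
      Real.exp (-∑ k, ν k * Real.log ‖x (Fin.castLE hs k)‖) := by
    intro x hx
    obtain ⟨z, hz, rfl⟩ := exists_expCoord_eq hs hx
    simp only [log_norm_expCoord]
    rw [hu₀G z hz, norm_mul, norm_exp, neg_re, re_sum]
    simp only [re_ofReal_mul]
    exact mul_le_of_le_one_left (Real.exp_pos _).le (hle z hz)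
  obtain ⟨u, hu, huu⟩ := exists_differentiableOn_ball_extension hs hu₀ fun y hy j hj hk => by
    obtain ⟨C, hC⟩ := exists_sum_log_le hs ν hj hk
    refine isLittleO_inv_of_norm_le_exp (C := C) (hν j) ?_
    filter_upwards [eventually_add_smul_mem_ballCompl hs hy hj hk, hC] with ζ h1 h2
    exact (hbound _ h1).trans (Real.exp_le_exp.2 h2)
  refine ⟨u, hu, fun z hz => ?_⟩
  rw [huu _ (expCoord_mem_ballCompl hs hz), hu₀G z hz, mul_assoc, ← exp_add]
  simp

end

/-- `log G` takes values in the strip `0 < Im < π` and is translated by `log (a j)`. The sign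
conclusion of `parabolic_extension`, applied to `log G` and to `πi - log G`, gives `log (a j) ≥ 0`
and `≤ 0`. -/
theorem homothety_eq_one {n s : ℕ} (hs : s ≤ n) {r : ℝ} (hr : 0 < r) {G : Cn n → ℂ} (hG : DifferentiableOn ℂ G (logDomain n s r))
    (him : ∀ z ∈ logDomain n s r, 0 < (G z).im) (a : Fin s → ℝ) (ha : ∀ j, 0 < a j)
    (hshift : ∀ j : Fin s, ∀ z ∈ logDomain n s r,
      G (z + latticeShift (Pi.single j 1)) = a j * G z) (j : Fin s) : a j = 1 := by
  have hslit : ∀ z ∈ logDomain n s r, G z ∈ slitPlane := fun z hz => Or.inr (him z hz).ne'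
  have hL : DifferentiableOn ℂ (fun z => log (G z)) (logDomain n s r) := hG.clog hslit
  have hLs : ∀ j : Fin s, ∀ z ∈ logDomain n s r,
      log (G (z + latticeShift (Pi.single j 1))) = log (G z) + (Real.log (a j) : ℝ) := by
    intro j z hz
    rw [hshift j z hz, log_ofReal_mul (ha j) (slitPlane_ne_zero (hslit z hz)), add_comm]
  have h1 := (parabolic_extension hs hr hL (fun z hz => by
    rw [log_im]; exact arg_nonneg_iff.2 (him z hz).le) _ hLs).1 j
  have h2 := (parabolic_extension hs hr (G := fun z => Real.pi * I - log (G z))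
    (hL.const_sub _) (fun z hz => by
      have := arg_le_pi (G z)
      simpa [log_im] using this) (fun j => -Real.log (a j)) (fun j z hz => by
      rw [hLs j z hz]; push_cast; ring)).1 j
  rw [← Real.exp_log (ha j), le_antisymm (by linarith) h1, Real.exp_zero]

/-! ### The universal covering as the convex domain `logDomain`; deck transformations. -/

theorem IsLocalHomeomorph.locallyPathConnectedSpace {X Y : Type*} [TopologicalSpace X]
    [TopologicalSpace Y] [LocallyPathConnectedSpace Y] {f : X → Y} (hf : IsLocalHomeomorph f) :
    LocallyPathConnectedSpace X := by
  choose c hc _ using hf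
  let _ : ChartedSpace Y X :=
    { atlas := range c
      chartAt := c
      mem_chart_source := hc
      chart_mem_atlas := fun x => mem_range_self x }
  exact ChartedSpace.locallyPathConnectedSpace Y X

/-- A global chart of the covering space `E` with values in `logDomain`, with inverse `Q`. -/
structure Uniformization {n s : ℕ} {hs : s ≤ n} {r : ℝ} {E : Type*} [TopologicalSpace E]
    (p : E → ballCompl n s hs r) where
  Λ : E → Cn n
  Q : Cn n → E
  continuous_Λ : Continuous Λ
  continuousOn_Q : ContinuousOn Q (logDomain n s r)
  mem : ∀ e, Λ e ∈ logDomain n s r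
  Q_Λ : ∀ e, Q (Λ e) = e
  Λ_Q : ∀ z ∈ logDomain n s r, Λ (Q z) = z
  expCoord_Λ : ∀ e, expCoord s (Λ e) = p e

section

variable {n s : ℕ} {hs : s ≤ n} {r : ℝ} {E : Type*} [TopologicalSpace E]
  {p : E → ballCompl n s hs r}

/-- `Λ` collects continuous logarithms of the first `s` coordinates, which exist because `E` is
simply connected. `Q` lifts `expCoord` through `p`, which is possible because `logDomain` is
contractible. Uniqueness of lifts makes them mutually inverse. -/
theorem nonempty_uniformization (hr : 0 < r) [SimplyConnectedSpace E] (hp : IsCoveringMap p)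
    (e₀ : E) : Nonempty (Uniformization p) := by
  have : LocallyPathConnectedSpace (ballCompl n s hs r) :=
    (isOpen_ballCompl hs r).locallyPathConnectedSpace
  have : LocallyPathConnectedSpace E := hp.isLocalHomeomorph.locallyPathConnectedSpace
  have hlog : ∀ j : Fin s, ∃ ℓ : C(E, ℂ), ∀ e, exp (ℓ e) = (p e : Cn n) (Fin.castLE hs j) := by
    intro j
    have hc : Continuous fun e => (p e : Cn n) (Fin.castLE hs j) :=
      (by fun_prop : Continuous fun x : Cn n => x (Fin.castLE hs j)).comp
        (continuous_subtype_val.comp hp.continuous)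
    obtain ⟨ℓ, ⟨-, hℓ⟩, -⟩ := isCoveringMapOn_exp.existsUnique_continuousMap_lifts
      ⟨_, hc⟩ (a₀ := e₀) (e₀ := log ((p e₀ : Cn n) (Fin.castLE hs j)))
      (exp_log ((p e₀).2.2 j)) (fun e => (p e).2.2 j)
    exact ⟨ℓ, fun e => congrFun hℓ e⟩
  choose ℓ hℓ using hlog
  let Λ : E → Cn n := fun e =>
    WithLp.toLp 2 fun i => if h : (i : ℕ) < s then ℓ ⟨i, h⟩ e else (p e : Cn n) i
  have hΛc : Continuous Λ := by
    refine (PiLp.continuous_toLp 2 _).comp (continuous_pi fun i => ?_)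
    by_cases h : (i : ℕ) < s
    · simp only [h, dite_true]; exact (ℓ ⟨i, h⟩).continuous
    · simp only [h, dite_false]
      exact (by fun_prop : Continuous fun x : Cn n => x i).comp
        (continuous_subtype_val.comp hp.continuous)
  have hΛ : ∀ e, expCoord s (Λ e) = p e := by
    intro e
    ext i
    by_cases h : (i : ℕ) < s
    · simp only [expCoord, Λ, h, if_true, dite_true]; exact hℓ ⟨i, h⟩ e
    · simp [expCoord, Λ, h]
  have hmem : ∀ e, Λ e ∈ logDomain n s r := fun e => by
    rw [logDomain, mem_ofPred_eq, hΛ]; exact (p e).2.1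
  have hne := logDomain_nonempty hr hs
  have : ContractibleSpace (logDomain n s r) := convex_logDomain.contractibleSpace hne
  have : LocallyPathConnectedSpace (logDomain n s r) := isOpen_logDomain.locallyPathConnectedSpace
  obtain ⟨Q, ⟨hQ0, hQ⟩, -⟩ := hp.existsUnique_continuousMap_lifts
    (⟨fun z : logDomain n s r => ⟨expCoord s z, expCoord_mem_ballCompl hs z.2⟩,
      (differentiable_expCoord.continuous.comp continuous_subtype_val).subtype_mk _⟩ :
      C(logDomain n s r, ballCompl n s hs r)) ⟨Λ e₀, hmem e₀⟩ e₀ (Subtype.ext (hΛ e₀).symm)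
  have hΛc' : Continuous fun e => (⟨Λ e, hmem e⟩ : logDomain n s r) := hΛc.subtype_mk _
  have hpQ : ∀ z : logDomain n s r, (p (Q z) : Cn n) = expCoord s z := fun z =>
    congrArg Subtype.val (congrFun hQ z)
  have hQΛ : (fun e => Q ⟨Λ e, hmem e⟩) = id :=
    hp.eq_of_comp_eq (Q.continuous.comp hΛc') continuous_id
      (funext fun e => Subtype.ext (by simp [hpQ, hΛ])) e₀ hQ0
  have hΛQ : ∀ z : logDomain n s r, Λ (Q z) = z := by
    intro z
    have hexp : ∀ z : logDomain n s r, expCoord s (Λ (Q z)) = expCoord s z := fun z => by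
      rw [hΛ, hpQ]
    ext i
    by_cases h : (i : ℕ) < s
    · have hci : Continuous fun x : Cn n => x i := by fun_prop
      refine congrFun (isCoveringMap_exp.eq_of_comp_eq
        (g₁ := fun z : logDomain n s r => Λ (Q z) i) (g₂ := fun z => (z : Cn n) i)
        (hci.comp (hΛc.comp Q.continuous)) (hci.comp continuous_subtype_val)
        (funext fun z => Subtype.ext ?_) ⟨Λ e₀, hmem e₀⟩ ?_) z
      · have := congrArg (fun x : Cn n => x i) (hexp z)
        simpa [expCoord, h] using this
      · simp only [hQ0]
    · have := congrArg (fun x : Cn n => x i) (hexp z)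
      simpa [expCoord, h] using this
  classical
  refine ⟨⟨Λ, fun z => if h : z ∈ logDomain n s r then Q ⟨z, h⟩ else e₀, hΛc, ?_, hmem,
    fun e => ?_, fun z hz => ?_, hΛ⟩⟩
  · rw [continuousOn_iff_continuous_domRestrict]
    convert! Q.continuous using 2 with z
    simp
  · simpa [hmem e] using congrFun hQΛ e
  · simpa [hz] using hΛQ ⟨z, hz⟩

namespace Uniformization

variable (S : Uniformization p)

theorem p_Q {z : Cn n} (hz : z ∈ logDomain n s r) : (p (S.Q z) : Cn n) = expCoord s z := by
  rw [← S.expCoord_Λ, S.Λ_Q z hz]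

theorem isLogBranch (j : Fin s) :
    IsLogBranch p (Fin.castLE hs j) (fun e => S.Λ e (Fin.castLE hs j)) :=
  ⟨(by fun_prop : Continuous fun x : Cn n => x (Fin.castLE hs j)).comp S.continuous_Λ,
    fun e => by rw [← expCoord_apply_castLE, S.expCoord_Λ]⟩

/-- `Q ∘ logCoord` is a local section of `p`, and composing it with `expCoord` recovers `Q` near
`z₀`. -/
theorem differentiableOn_comp_Q {F : E → ℂ} (hF : IsHolomorphicOnCover p F) :
    DifferentiableOn ℂ (fun z => F (S.Q z)) (logDomain n s r) := by
  intro z₀ hz₀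
  refine DifferentiableAt.differentiableWithinAt ?_
  obtain ⟨U, hU, hzU, hUX, hd, hmaps⟩ := exists_logCoord_nhds hs hz₀
  have hsec : IsLocalSection p U fun x => S.Q (logCoord s z₀ x) :=
    ⟨hU, S.continuousOn_Q.comp hd.continuousOn hmaps, fun x hx => by
      rw [S.p_Q (hmaps hx), expCoord_logCoord hs z₀ (hUX hx).2]⟩
  have h1 := (hF U _ hsec).differentiableAt (hU.mem_nhds hzU)
  refine (h1.comp z₀ (differentiable_expCoord z₀)).congr_of_eventuallyEq ?_
  filter_upwards [logCoord_expCoord_eventuallyEq (s := s) z₀] with z hz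
  simp only [Function.comp, hz]

/-- The deck transformation induced by a lattice translation. -/
noncomputable def deck (k : Fin s → ℤ) : E ≃ₜ E where
  toFun e := S.Q (S.Λ e + latticeShift k)
  invFun e := S.Q (S.Λ e + latticeShift (-k))
  left_inv e := by
    simp only
    rw [S.Λ_Q _ (add_latticeShift_mem (S.mem e) k), add_assoc, ← latticeShift_add, add_neg_cancel,
      latticeShift_zero, add_zero, S.Q_Λ]
  right_inv e := by
    simp only
    rw [S.Λ_Q _ (add_latticeShift_mem (S.mem e) _), add_assoc, ← latticeShift_add, neg_add_cancel,
      latticeShift_zero, add_zero, S.Q_Λ]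
  continuous_toFun := S.continuousOn_Q.comp_continuous (S.continuous_Λ.add continuous_const)
    fun e => add_latticeShift_mem (S.mem e) k
  continuous_invFun := S.continuousOn_Q.comp_continuous (S.continuous_Λ.add continuous_const)
    fun e => add_latticeShift_mem (S.mem e) _

theorem deck_Q (k : Fin s → ℤ) {z : Cn n} (hz : z ∈ logDomain n s r) :
    S.deck k (S.Q z) = S.Q (z + latticeShift k) := by
  simp [deck, S.Λ_Q z hz]

theorem p_deck (k : Fin s → ℤ) (e : E) : p (S.deck k e) = p e := by
  refine Subtype.ext ?_
  change (p (S.Q (S.Λ e + latticeShift k)) : Cn n) = _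
  rw [S.p_Q (add_latticeShift_mem (S.mem e) k), expCoord_add_latticeShift, S.expCoord_Λ]

/-- Any path from `e₀` to its translate projects to a loop representing the required class. -/
theorem exists_rho_of_shift [PathConnectedSpace E] (hp : Continuous p) {e₀ : E}
    {ρ : FundamentalGroup (ballCompl n s hs r) (p e₀) →* DiscAut} {D : E → 𝔻}
    (h : IsEquivariant p e₀ ρ D) (k : Fin s → ℤ) :
    ∃ γ, ∀ z ∈ logDomain n s r, D (S.Q (z + latticeShift k)) = (ρ γ).1 (D (S.Q z)) := by
  let Γ : Path e₀ (S.deck k e₀) := PathConnectedSpace.somePath _ _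
  refine ⟨FundamentalGroup.fromPath (Path.Homotopic.Quotient.mk
    ((Γ.map hp).cast rfl (S.p_deck k e₀).symm)), fun z hz => ?_⟩
  rw [← S.deck_Q k hz]
  exact h (S.deck k) (S.p_deck k) _ Γ (fun t => rfl) _

/-- The lift of the loop ends in the fibre of `e₀`, and the fibres of `expCoord` are lattice orbits.
The hyperbolic case needs this direction, to get `ρ = 1` on the whole group and not only on the
classes attached to the generators. -/
theorem exists_shift_of_rho (hp : IsCoveringMap p) {e₀ : E}
    {ρ : FundamentalGroup (ballCompl n s hs r) (p e₀) →* DiscAut} {D : E → 𝔻}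
    (h : IsEquivariant p e₀ ρ D) (γ : FundamentalGroup (ballCompl n s hs r) (p e₀)) :
    ∃ k : Fin s → ℤ, ∀ z ∈ logDomain n s r, D (S.Q (z + latticeShift k)) = (ρ γ).1 (D (S.Q z)) := by
  obtain ⟨c, rfl⟩ : ∃ c : Path (p e₀) (p e₀),
      FundamentalGroup.fromPath (Path.Homotopic.Quotient.mk c) = γ := by
    obtain ⟨c, hc⟩ := Quotient.exists_rep (FundamentalGroup.toPath γ)
    exact ⟨c, congrArg FundamentalGroup.fromPath hc⟩
  have hc0 : c.toContinuousMap 0 = p e₀ := c.source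
  have hlift : ∀ t, p (hp.liftPath c.toContinuousMap e₀ hc0 t) = c t := fun t =>
    congrFun (hp.liftPath_lifts c.toContinuousMap e₀ hc0) t
  set e₁ := hp.liftPath c.toContinuousMap e₀ hc0 1
  have he₁ : p e₁ = p e₀ := (hlift 1).trans c.target
  obtain ⟨k, hk⟩ := expCoord_eq_iff.1
    (show expCoord s (S.Λ e₁) = expCoord s (S.Λ e₀) by rw [S.expCoord_Λ, S.expCoord_Λ, he₁])
  have hdeck : S.deck k e₀ = e₁ := by
    change S.Q (S.Λ e₀ + latticeShift k) = e₁
    rw [← hk, S.Q_Λ]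
  refine ⟨k, fun z hz => ?_⟩
  rw [← S.deck_Q k hz]
  exact h (S.deck k) (S.p_deck k) c
    ⟨hp.liftPath c.toContinuousMap e₀ hc0, hp.liftPath_zero .., hdeck.symm⟩ hlift _

end Uniformization

end

/-! ### Hyperbolic, parabolic and elliptic monodromy on the covering. -/

theorem exists_circle_eq_exp (a : Circle) :
    ∃ ν : ℝ, 0 ≤ ν ∧ ν < 1 ∧ (a : ℂ) = exp (ν * (2 * Real.pi * I)) := by
  set t : ℝ := arg a / (2 * Real.pi)
  refine ⟨Int.fract t, Int.fract_nonneg t, Int.fract_lt_one t, ?_⟩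
  have h1 : ((Int.fract t : ℝ) : ℂ) * (2 * Real.pi * I) = arg a * I - ⌊t⌋ * (2 * Real.pi * I) := by
    have h2 : (arg a : ℂ) = t * (2 * Real.pi) := by
      have := Real.pi_ne_zero
      simp only [t]; push_cast; field_simp
    have h3 : ((Int.fract t : ℝ) : ℂ) = t - ⌊t⌋ := by rw [Int.fract]; push_cast; rfl
    rw [h2, h3]; ring
  rw [h1, exp_sub, exp_int_mul_two_pi_mul_I, div_one]
  have := norm_mul_exp_arg_mul_I (a : ℂ)
  rw [Circle.norm_coe] at this
  simpa using this.symm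

namespace Uniformization

variable {n s : ℕ} {hs : s ≤ n} {r : ℝ} {E : Type*} [TopologicalSpace E]
  {p : E → ballCompl n s hs r} {D : E → 𝔻}

theorem differentiableOn_biholomorphism_comp (S : Uniformization p) {B : Type} {b : B → ℂ} {h : 𝔻 ≃ B}
    (hh : IsBiholomorphism UnitDisc.coe b h) (hD : IsHolomorphicOnCover p fun e => (D e : ℂ)) :
    DifferentiableOn ℂ (fun z => b (h (D (S.Q z)))) (logDomain n s r) := by
  obtain ⟨⟨g, hg, hgh⟩, -⟩ := hh
  simp only [hgh]
  exact hg.comp (S.differentiableOn_comp_Q hD) fun z _ => mem_range_self _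

variable [PathConnectedSpace E] {e₀ : E} {ρ : FundamentalGroup (ballCompl n s hs r) (p e₀) →* DiscAut}

theorem not_isHyperbolicType (S : Uniformization p) (hr : 0 < r) (hp : IsCoveringMap p)
    (hD : IsHolomorphicOnCover p fun e => (D e : ℂ)) (hequiv : IsEquivariant p e₀ ρ D) :
    ¬ IsHyperbolicType ρ := by
  rintro ⟨hρ, h, hh, hρh⟩
  have hG := S.differentiableOn_biholomorphism_comp hh hD
  choose γ hγ using fun j : Fin s => S.exists_rho_of_shift hp.continuous hequiv (Pi.single j 1)
  choose a ha hρa using hρh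
  have hshift : ∀ j : Fin s, ∀ z ∈ logDomain n s r,
      (h (D (S.Q (z + latticeShift (Pi.single j 1)))) : ℂ) = a (γ j) * h (D (S.Q z)) := by
    intro j z hz
    have := hρa (γ j) (h (D (S.Q z)))
    rwa [Equiv.symm_apply_apply, ← hγ j z hz] at this
  have hone := homothety_eq_one hs hr hG (fun z _ => (h (D (S.Q z))).im_pos) _
    (fun j => ha (γ j)) hshift
  -- Descent serves here only to pass from invariance under the generators to invariance under the
  -- full lattice.
  obtain ⟨g, -, hg⟩ := exists_descent hs hG fun j z hz => by rw [hshift j z hz, hone]; simp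
  obtain ⟨z, hz⟩ := logDomain_nonempty hr hs
  refine hρ (MonoidHom.ext fun γ => ?_)
  obtain ⟨k, hk⟩ := S.exists_shift_of_rho hp hequiv γ
  have h1 := hρa γ (h (D (S.Q z)))
  rw [Equiv.symm_apply_apply, ← hk z hz, ← hg _ (add_latticeShift_mem hz k),
    expCoord_add_latticeShift, hg z hz] at h1
  have h2 : (a γ : ℂ) = 1 := by
    have h3 : ((h (D (S.Q z)) : ℍ) : ℂ) ≠ 0 := UpperHalfPlane.ne_zero _
    exact (mul_right_cancel₀ h3 (by rw [← h1, one_mul]))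
  refine Subtype.ext (Equiv.ext fun x => h.injective (UpperHalfPlane.ext ?_))
  have h4 := hρa γ (h x)
  rw [h2, one_mul, Equiv.symm_apply_apply] at h4
  exact h4

theorem parabolic (S : Uniformization p) (hr : 0 < r) (hp : Continuous p)
    (hD : IsHolomorphicOnCover p fun e => (D e : ℂ)) (hequiv : IsEquivariant p e₀ ρ D)
    {h : 𝔻 ≃ ℍ} (hρ : IsParabolicVia ρ h) :
    ∃ (g : Cn n → ℂ) (lam : Fin s → ℝ) (ℓ : Fin s → E → ℂ),
      DifferentiableOn ℂ g (ball (0 : Cn n) r) ∧ (∀ i, 0 ≤ lam i) ∧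
      (∀ i, IsLogBranch p (Fin.castLE hs i) (ℓ i)) ∧
      ∀ e, (h (D e) : ℂ) =
        1 / (2 * Real.pi * I) * ∑ i, (lam i : ℂ) * ℓ i e + g (p e) := by
  obtain ⟨hh, hρh⟩ := hρ
  choose γ hγ using fun j : Fin s => S.exists_rho_of_shift hp hequiv (Pi.single j 1)
  choose a hρa using hρh
  obtain ⟨ha, g, hg, hgG⟩ := parabolic_extension hs hr
    (S.differentiableOn_biholomorphism_comp hh hD)
    (fun z _ => (h (D (S.Q z))).im_pos.le) (fun j => a (γ j)) (fun j z hz => by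
      have := hρa (γ j) (h (D (S.Q z)))
      rwa [Equiv.symm_apply_apply, ← hγ j z hz] at this)
  refine ⟨g, _, fun j e => S.Λ e (Fin.castLE hs j), hg, ha, S.isLogBranch, fun e => ?_⟩
  have := hgG _ (S.mem e)
  rwa [S.Q_Λ, S.expCoord_Λ] at this

theorem elliptic (S : Uniformization p) (hp : Continuous p)
    (hD : IsHolomorphicOnCover p fun e => (D e : ℂ)) (hequiv : IsEquivariant p e₀ ρ D)
    {h : DiscAut} (hρ : IsEllipticVia ρ h) :
    ∃ (u : Cn n → ℂ) (ν : Fin s → ℝ) (ℓ : Fin s → E → ℂ),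
      DifferentiableOn ℂ u (ball (0 : Cn n) r) ∧ (∀ i, 0 ≤ ν i ∧ ν i < 1) ∧
      (∀ i, IsLogBranch p (Fin.castLE hs i) (ℓ i)) ∧
      ∀ e, (h.1 (D e) : ℂ) = u (p e) * ∏ i, exp ((ν i : ℂ) * ℓ i e) := by
  choose γ hγ using fun j : Fin s => S.exists_rho_of_shift hp hequiv (Pi.single j 1)
  choose a hρa using hρ
  choose ν hν0 hν1 hν using fun j => exists_circle_eq_exp (a (γ j))
  obtain ⟨u, hu, huG⟩ := elliptic_extension hs
    (S.differentiableOn_biholomorphism_comp h.2 hD)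
    (fun z _ => (h.1 (D (S.Q z))).norm_lt_one.le) ν hν1 (fun j z hz => by
      have h1 := hρa (γ j) (h.1 (D (S.Q z)))
      have h2 : (h * ρ (γ j) * h⁻¹ : DiscAut).1 (h.1 (D (S.Q z))) =
          h.1 ((ρ (γ j)).1 (D (S.Q z))) := by
        simp [Equiv.Perm.mul_apply]
      rw [h2, ← hγ j z hz] at h1
      rw [h1, UnitDisc.coe_circle_smul, hν])
  refine ⟨u, ν, fun j e => S.Λ e (Fin.castLE hs j), hu, fun j => ⟨hν0 j, hν1 j⟩, S.isLogBranch,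
    fun e => ?_⟩
  have := huG _ (S.mem e)
  rwa [S.Q_Λ, S.expCoord_Λ, exp_sum] at this

end Uniformization

/-! ### Automorphisms of the disc and of the half-plane -/

theorem range_unitDisc_coe : range UnitDisc.coe = ball (0 : ℂ) 1 := by
  ext z
  rw [mem_ball_zero_iff]
  exact ⟨by rintro ⟨x, rfl⟩; exact x.norm_lt_one, fun h => ⟨UnitDisc.mk z h, rfl⟩⟩

/-- Schwarz's lemma for `k` and for its inverse gives `|k x| = |x|`; equality at the single nonzero
point `1/2` already forces a rotation. -/
theorem IsBiholomorphism.norm_eq_of_map_zero {k : 𝔻 ≃ 𝔻}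
    (hk : IsBiholomorphism UnitDisc.coe UnitDisc.coe k) (h0 : k 0 = 0) :
    ∃ κ : ℂ, ‖κ‖ = 1 ∧ ∀ x, (k x : ℂ) = κ * x := by
  have hle : ∀ {k : 𝔻 ≃ 𝔻}, IsBiholomorphism UnitDisc.coe UnitDisc.coe k → k 0 = 0 →
      ∃ f : ℂ → ℂ, DifferentiableOn ℂ f (ball 0 1) ∧ MapsTo f (ball 0 1) (closedBall (f 0) 1) ∧
        f 0 = 0 ∧ (∀ x, (k x : ℂ) = f x) ∧ ∀ x, ‖(k x : ℂ)‖ ≤ ‖(x : ℂ)‖ := by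
    rintro k ⟨⟨f, hf, hkf⟩, -⟩ h0
    rw [range_unitDisc_coe] at hf
    have hf0 : f 0 = 0 := by simpa [h0] using (hkf 0).symm
    have hmaps : MapsTo f (ball 0 1) (closedBall (f 0) 1) := by
      intro z hz
      rw [hf0, mem_closedBall_zero_iff]
      have := hkf (UnitDisc.mk z (mem_ball_zero_iff.1 hz))
      rw [UnitDisc.coe_mk] at this
      rw [← this]
      exact (UnitDisc.norm_lt_one _).le
    refine ⟨f, hf, hmaps, hf0, hkf, fun x => ?_⟩
    rw [hkf]
    exact Complex.norm_le_norm_of_mapsTo_ball hf (by rwa [hf0] at hmaps) hf0 x.norm_lt_one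
  obtain ⟨f, hf, hmaps, hf0, hkf, hle1⟩ := hle hk h0
  obtain ⟨-, -, -, -, -, hle2⟩ := hle hk.symm (by rw [Equiv.symm_apply_eq, h0])
  set x : 𝔻 := UnitDisc.mk (1 / 2) (by norm_num)
  have hx : (x : ℂ) = 1 / 2 := rfl
  have hnorm : ‖f (1 / 2)‖ = 1 / 2 := by
    have h1 := hle1 x
    have h2 := hle2 (k x)
    rw [Equiv.symm_apply_apply] at h2
    rw [← hx, ← hkf, le_antisymm h1 h2, hx]
    norm_num
  obtain ⟨κ, hκ, heq⟩ := Complex.affine_of_mapsTo_ball_of_exists_norm_dslope_eq_div' hf hmaps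
    ⟨1 / 2, by rw [mem_ball_zero_iff]; norm_num, by
      rw [dslope_of_ne _ (by norm_num), slope_def_module, hf0, sub_zero, sub_zero, norm_smul, hnorm]
      norm_num⟩
  refine ⟨κ, by simpa using hκ, fun y => ?_⟩
  rw [hkf, heq (mem_ball_zero_iff.2 y.norm_lt_one), hf0]
  simp [mul_comm]

theorem UpperHalfPlane.norm_sub_I_lt (w : ℍ) : ‖(w : ℂ) - Complex.I‖ < ‖(w : ℂ) + Complex.I‖ := by
  have := w.im_pos
  rw [← sq_lt_sq₀ (norm_nonneg _) (norm_nonneg _), ← normSq_eq_norm_sq, ← normSq_eq_norm_sq]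
  simp only [normSq_apply, sub_re, sub_im, add_re, add_im, Complex.I_re, Complex.I_im, UpperHalfPlane.coe_re,
    UpperHalfPlane.coe_im]
  nlinarith

theorem UpperHalfPlane.add_I_ne_zero (w : ℍ) : (w : ℂ) + Complex.I ≠ 0 :=
  norm_pos_iff.1 ((norm_nonneg _).trans_lt w.norm_sub_I_lt)

theorem Complex.UnitDisc.one_sub_coe_ne_zero (x : 𝔻) : (1 : ℂ) - x ≠ 0 :=
  sub_ne_zero.2 x.coe_ne_one.symm

/-- The Cayley transform from the unit disc to the upper half-plane. -/
noncomputable def cayley : 𝔻 ≃ ℍ where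
  toFun x := ⟨I * (1 + x) / (1 - x), by
    have h1 := x.one_sub_coe_ne_zero
    have h2 := x.normSq_lt_one
    have h3 : 0 < normSq (1 - (x : ℂ)) := normSq_pos.2 h1
    have h4 : (I * (1 + x) / (1 - x)).im = (1 - normSq (x : ℂ)) / normSq (1 - (x : ℂ)) := by
      rw [div_im, ← sub_div]
      congr 1
      simp [normSq_apply]
      ring
    rw [h4]
    exact div_pos (by linarith) h3⟩
  invFun w := UnitDisc.mk ((w - I) / (w + I)) (by
    rw [norm_div, div_lt_one (norm_pos_iff.2 w.add_I_ne_zero)]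
    exact w.norm_sub_I_lt)
  left_inv x := by
    rw [← UnitDisc.coe_inj, UnitDisc.coe_mk]
    have h1 := x.one_sub_coe_ne_zero
    have h2 : I * (1 + x) / (1 - x) + I ≠ 0 := by
      have : I * (1 + x) / (1 - x) + I = 2 * I / (1 - x) := by field_simp; ring
      rw [this]
      exact div_ne_zero (by simp) h1
    change (I * (1 + x) / (1 - x) - I) / (I * (1 + x) / (1 - x) + I) = (x : ℂ)
    rw [div_eq_iff h2]
    field_simp
    ring
  right_inv w := by
    ext
    have h1 := w.add_I_ne_zero
    change I * (1 + (w - I) / (w + I)) / (1 - (w - I) / (w + I)) = (w : ℂ)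
    have h2 : 1 - ((w : ℂ) - I) / (w + I) = 2 * I / (w + I) := by field_simp; ring
    rw [h2]
    field_simp
    ring

theorem coe_cayley (x : 𝔻) : (cayley x : ℂ) = I * (1 + x) / (1 - x) := rfl

theorem coe_cayley_symm (w : ℍ) : (cayley.symm w : ℂ) = (w - I) / (w + I) := rfl

theorem isBiholomorphism_cayley : IsBiholomorphism UnitDisc.coe UpperHalfPlane.coe cayley := by
  refine ⟨⟨fun z => I * (1 + z) / (1 - z), ?_, coe_cayley⟩,
    ⟨fun w => (w - I) / (w + I), ?_, coe_cayley_symm⟩⟩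
  · refine DifferentiableOn.div (by fun_prop) (by fun_prop) ?_
    rintro _ ⟨x, rfl⟩; exact x.one_sub_coe_ne_zero
  · refine DifferentiableOn.div (by fun_prop) (by fun_prop) ?_
    rintro _ ⟨x, rfl⟩; exact x.add_I_ne_zero

theorem coe_sl_smul (g : SL(2, ℝ)) (w : ℍ) :
    ((g • w : ℍ) : ℂ) = ((g 0 0 : ℂ) * w + g 0 1) / ((g 1 0 : ℂ) * w + g 1 1) := by
  simpa using UpperHalfPlane.coe_specialLinearGroup_apply g w

theorem sl_denom_ne_zero (g : SL(2, ℝ)) (w : ℍ) : (g 1 0 : ℂ) * w + g 1 1 ≠ 0 :=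
  UpperHalfPlane.denom_ne_zero (g : GL (Fin 2) ℝ) w

theorem isBiholomorphism_sl_smul (g : SL(2, ℝ)) :
    IsBiholomorphism UpperHalfPlane.coe UpperHalfPlane.coe (MulAction.toPerm g : ℍ ≃ ℍ) := by
  have key : ∀ g : SL(2, ℝ), ∃ f : ℂ → ℂ, DifferentiableOn ℂ f (range UpperHalfPlane.coe) ∧
      ∀ w : ℍ, ((g • w : ℍ) : ℂ) = f w := fun g => by
    refine ⟨fun w => ((g 0 0 : ℂ) * w + g 0 1) / ((g 1 0 : ℂ) * w + g 1 1), ?_, coe_sl_smul g⟩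
    refine DifferentiableOn.div (by fun_prop) (by fun_prop) ?_
    rintro _ ⟨w, rfl⟩; exact sl_denom_ne_zero g w
  exact ⟨key g, key g⁻¹⟩

/-- Every biholomorphic automorphism of the half-plane is a real Möbius transformation. -/
theorem IsBiholomorphism.exists_sl_smul_eq {H : ℍ ≃ ℍ}
    (hH : IsBiholomorphism UpperHalfPlane.coe UpperHalfPlane.coe H) :
    ∃ g : SL(2, ℝ), ∀ w, H w = g • w := by
  -- By transitivity one may assume that `I` is fixed; the Cayley transform then produces a disc
  -- automorphism fixing `0`.
  obtain ⟨g₀, hg₀⟩ := MulAction.exists_smul_eq SL(2, ℝ) (H UpperHalfPlane.I) UpperHalfPlane.I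
  set K : ℍ ≃ ℍ := H.trans (MulAction.toPerm g₀)
  have hK : IsBiholomorphism UpperHalfPlane.coe UpperHalfPlane.coe K :=
    hH.trans (isBiholomorphism_sl_smul g₀)
  have hKI : K UpperHalfPlane.I = UpperHalfPlane.I := hg₀
  have hc0 : cayley 0 = UpperHalfPlane.I := by ext; simp [coe_cayley]
  obtain ⟨κ, hκ, hk⟩ := ((isBiholomorphism_cayley.trans hK).trans
    isBiholomorphism_cayley.symm).norm_eq_of_map_zero (by
      simp only [Equiv.trans_apply, hc0, hKI]
      rw [Equiv.symm_apply_eq, hc0])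
  -- Half the angle, since the rotation matrix of angle `θ` acts on the disc as multiplication by
  -- `e^(2iθ)`.
  set θ : ℝ := arg κ / 2
  let R : SL(2, ℝ) := ⟨!![Real.cos θ, Real.sin θ; -Real.sin θ, Real.cos θ], by
    rw [Matrix.det_fin_two_of]; nlinarith [Real.sin_sq_add_cos_sq θ]⟩
  have hR : ∀ w, K w = R • w := by
    intro w
    refine cayley.symm.injective (UnitDisc.coe_inj.1 ?_)
    have h1 := hk (cayley.symm w)
    simp only [Equiv.trans_apply, Equiv.apply_symm_apply] at h1
    have hden : -(Real.sin θ : ℂ) * w + Real.cos θ ≠ 0 := by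
      have := sl_denom_ne_zero R w
      simpa [R] using this
    have hRw : ((R • w : ℍ) : ℂ) = ((Real.cos θ : ℂ) * w + Real.sin θ) /
        (-(Real.sin θ : ℂ) * w + Real.cos θ) := by
      rw [coe_sl_smul]; simp [R]
    have hκθ : κ = (Real.cos θ + Real.sin θ * I) * (Real.cos θ + Real.sin θ * I) := by
      have := norm_mul_exp_arg_mul_I κ
      rw [hκ, ofReal_one, one_mul] at this
      rw [← this, ofReal_cos, ofReal_sin, ← exp_mul_I, ← exp_add]
      congr 1
      simp only [θ]; push_cast; ring
    have hcs : ((Real.cos θ : ℂ) + Real.sin θ * I) * (Real.cos θ - Real.sin θ * I) = 1 := by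
      have : (Real.sin θ : ℂ) ^ 2 + (Real.cos θ : ℂ) ^ 2 = 1 := by
        exact_mod_cast Real.sin_sq_add_cos_sq θ
      linear_combination this - (Real.sin θ : ℂ) ^ 2 * I_sq
    rw [h1, coe_cayley_symm, coe_cayley_symm]
    have hwI := w.add_I_ne_zero
    have hRI := (R • w).add_I_ne_zero
    have hsub : ((R • w : ℍ) : ℂ) - I = (Real.cos θ + Real.sin θ * I) * (w - I) /
        (-(Real.sin θ : ℂ) * w + Real.cos θ) := by
      rw [hRw, eq_div_iff hden, sub_mul, div_mul_cancel₀ _ hden]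
      linear_combination (Real.sin θ : ℂ) * I_sq
    have hadd : ((R • w : ℍ) : ℂ) + I = (Real.cos θ - Real.sin θ * I) * (w + I) /
        (-(Real.sin θ : ℂ) * w + Real.cos θ) := by
      rw [hRw, eq_div_iff hden, add_mul, div_mul_cancel₀ _ hden]
      linear_combination (Real.sin θ : ℂ) * I_sq
    rw [mul_div_assoc', div_eq_div_iff hwI hRI, hsub, hadd, hκθ]
    linear_combination ((Real.cos θ + Real.sin θ * I) * (w - I) * (w + I) /
      (-(Real.sin θ : ℂ) * w + Real.cos θ)) * hcs
  refine ⟨g₀⁻¹ * R, fun w => ?_⟩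
  rw [mul_smul, ← hR]
  exact (inv_smul_smul g₀ (H w)).symm

theorem exists_sl_smul_cayley (σ : DiscAut) : ∃ g : SL(2, ℝ), ∀ x, cayley (σ.1 x) = g • cayley x := by
  obtain ⟨g, hg⟩ := ((isBiholomorphism_cayley.symm.trans σ.2).trans
    isBiholomorphism_cayley).exists_sl_smul_eq
  exact ⟨g, fun x => by simpa using hg (cayley x)⟩

/-! ### Normal forms up to homography. -/

section

variable {n s : ℕ} (hs : s ≤ n) {r : ℝ}

/-- The multivalued function `u ∏ x_i ^ ν_i + ∑ μ_i log x_i` in exponential coordinates. -/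
noncomputable def elementaryForm (u : Cn n → ℂ) (ν μ : Fin s → ℂ) (z : Cn n) : ℂ :=
  u (expCoord s z) * exp (∑ i, ν i * z (Fin.castLE hs i)) + ∑ i, μ i * z (Fin.castLE hs i)

/-- `F` is a homographic function of an elementary form that is purely elliptic or purely
parabolic. -/
def HasNormalForm (r : ℝ) (F : Cn n → ℂ) : Prop :=
  ∃ a b c d : ℂ, a * d - b * c ≠ 0 ∧ ∃ (u : Cn n → ℂ) (ν μ : Fin s → ℂ),
    DifferentiableOn ℂ u (ball 0 r) ∧ (ν = 0 ∨ μ = 0) ∧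
    ∀ z ∈ logDomain n s r, F z * (c * elementaryForm hs u ν μ z + d) =
      a * elementaryForm hs u ν μ z + b

variable {hs}

/-- Stability under homographies permits conjugating the monodromy and passing between `𝔻` and `ℍ`.
Relations are cross-multiplied, so no denominator has to be checked. -/
theorem HasNormalForm.mobius {F F' : Cn n → ℂ} (hF : HasNormalForm hs r F) {α β γ δ : ℂ}
    (hdet : α * δ - β * γ ≠ 0)
    (h : ∀ z ∈ logDomain n s r, F' z * (γ * F z + δ) = α * F z + β) : HasNormalForm hs r F' := by
  obtain ⟨a, b, c, d, hN, u, ν, μ, hu, hνμ, hFW⟩ := hF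
  refine ⟨α * a + β * c, α * b + β * d, γ * a + δ * c, γ * b + δ * d, ?_, u, ν, μ, hu, hνμ,
    fun z hz => ?_⟩
  · have : (α * a + β * c) * (γ * b + δ * d) - (α * b + β * d) * (γ * a + δ * c) =
        (α * δ - β * γ) * (a * d - b * c) := by ring
    rw [this]
    exact mul_ne_zero hdet hN
  · have h1 := h z hz
    have h2 := hFW z hz
    generalize elementaryForm hs u ν μ z = W at h2 ⊢
    linear_combination (c * W + d) * h1 + (α - F' z * γ) * h2
end

/-! ### Real Möbius transformations: fixed points and commutation. -/

theorem sl_det_eq_one (g : SL(2, ℝ)) : g 0 0 * g 1 1 - g 0 1 * g 1 0 = 1 := by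
  rw [← Matrix.det_fin_two, Matrix.SpecialLinearGroup.det_coe]

/-- An element of `SL(2, ℝ)` with two distinct fixed points acts trivially. -/
theorem sl_fixedPoint_unique {g : SL(2, ℝ)} {w₀ z w : ℍ} (hg : g • w₀ ≠ w₀) (hz : g • z = z)
    (hw : g • w = w) : z = w := by
  have hpos : 0 < (g : GL (Fin 2) ℝ).val.det := by simp
  have hgc : (g : GL (Fin 2) ℝ) ∉ Subgroup.center _ := fun h =>
    hg (UpperHalfPlane.forall_smul_eq_self_iff_mem_center.2 h w₀)
  have hell := UpperHalfPlane.isElliptic_of_exists_smul_eq_self hpos hgc ⟨z, hz⟩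
  exact ((UpperHalfPlane.gl_smul_eq_self_iff_eq_fixedPt hpos hell).1 hz).trans
    ((UpperHalfPlane.gl_smul_eq_self_iff_eq_fixedPt hpos hell).1 hw).symm

/-- The commutator fixes both points, hence acts trivially by `sl_fixedPoint_unique`. -/
theorem sl_commute_of_two_points {g h : SL(2, ℝ)} {z w : ℍ} (hne : z ≠ w)
    (hz : g • h • z = h • g • z) (hw : g • h • w = h • g • w) (v : ℍ) :
    g • h • v = h • g • v := by
  have key : ∀ v : ℍ, g • h • v = h • g • v ↔ ((h * g)⁻¹ * (g * h)) • v = v := fun v => by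
    rw [mul_smul, inv_smul_eq_iff, mul_smul, mul_smul]
  rw [key] at *
  by_contra hv
  exact hne (sl_fixedPoint_unique hv hz hw)

theorem real_quadratic_eq_zero {A B C : ℝ}
    (h : ∀ w : ℍ, (A : ℂ) * (w : ℂ) ^ 2 + B * w + C = 0) : A = 0 ∧ B = 0 ∧ C = 0 := by
  have h1 := h ⟨I, by simp⟩
  have h2 := h ⟨2 * I, by simp⟩
  have e1 := congrArg re h1
  have e2 := congrArg im h1
  have e3 := congrArg re h2
  simp [pow_two] at e1 e2 e3
  exact ⟨by linarith, e2, by linarith⟩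

/-- If `N w = l w + t` commutes with a real Möbius transformation, the latter is determined by
algebraic equations. -/
theorem sl_commute_affine {g h : SL(2, ℝ)} {l t : ℝ} (hh : ∀ w : ℍ, ((h • w : ℍ) : ℂ) = l * w + t)
    (hcomm : ∀ w : ℍ, g • h • w = h • g • w) :
    g 0 0 * l * g 1 0 - g 1 0 * l * (l * g 0 0 + t * g 1 0) = 0 ∧
    g 0 0 * l * g 1 1 + (g 0 0 * t + g 0 1) * g 1 0 -
      ((l * g 0 0 + t * g 1 0) * (g 1 0 * t + g 1 1) + (l * g 0 1 + t * g 1 1) * g 1 0 * l) = 0 ∧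
    (g 0 0 * t + g 0 1) * g 1 1 - (l * g 0 1 + t * g 1 1) * (g 1 0 * t + g 1 1) = 0 := by
  refine real_quadratic_eq_zero fun w => ?_
  have h1 := congrArg UpperHalfPlane.coe (hcomm w)
  have hd1 := sl_denom_ne_zero g w
  have hd2 := sl_denom_ne_zero g (h • w)
  rw [hh, coe_sl_smul g w, coe_sl_smul g (h • w)] at h1
  rw [hh] at h1 hd2
  rw [div_eq_iff hd2] at h1
  have h2 : (((g 0 0 : ℂ) * (l * w + t) + g 0 1)) * ((g 1 0 : ℂ) * w + g 1 1) =
      (l * ((g 0 0 : ℂ) * w + g 0 1) + t * ((g 1 0 : ℂ) * w + g 1 1)) *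
        ((g 1 0 : ℂ) * (l * w + t) + g 1 1) := by
    rw [h1]
    linear_combination l * ((g 1 0 : ℂ) * (l * w + t) + g 1 1) *
      div_mul_cancel₀ ((g 0 0 : ℂ) * w + g 0 1) hd1
  push_cast
  linear_combination h2

theorem sl_smul_eq_affine {g : SL(2, ℝ)} (hg : g 1 0 = 0) (w : ℍ) :
    ((g • w : ℍ) : ℂ) = (g 0 0 ^ 2 : ℝ) * w + (g 0 1 * g 0 0 : ℝ) := by
  have hd := sl_denom_ne_zero g w
  have hdet := sl_det_eq_one g
  rw [hg] at hdet hd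
  have h1 : (g 1 1 : ℂ) * g 0 0 = 1 := by
    have : g 1 1 * g 0 0 = 1 := by linarith
    exact_mod_cast this
  rw [coe_sl_smul, hg, div_eq_iff hd]
  push_cast
  linear_combination -((g 0 0 : ℂ) * w + g 0 1) * h1

/-! ### Normal form of an equivariant map to the half-plane. -/

/-- A holomorphic map from `logDomain` to the half-plane, equivariant for Möbius
transformations. -/
structure MobiusEquivariant {n s : ℕ} (r : ℝ) (G : Cn n → ℍ) (M : Fin s → SL(2, ℝ)) : Prop where
  differentiableOn : DifferentiableOn ℂ (fun z => (G z : ℂ)) (logDomain n s r)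
  shift : ∀ j, ∀ z ∈ logDomain n s r, G (z + latticeShift (Pi.single j 1)) = M j • G z

namespace MobiusEquivariant

variable {n s : ℕ} {hs : s ≤ n} {r : ℝ} {G : Cn n → ℍ} {M : Fin s → SL(2, ℝ)}

theorem conj (h : MobiusEquivariant r G M) (P : SL(2, ℝ)) :
    MobiusEquivariant r (fun z => P • G z) (fun j => P * M j * P⁻¹) := by
  refine ⟨?_, fun j z hz => ?_⟩
  · obtain ⟨⟨f, hf, hPf⟩, -⟩ := isBiholomorphism_sl_smul P
    exact (hf.comp h.differentiableOn fun z _ => mem_range_self (G z)).congr fun z _ => hPf (G z)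
  · rw [h.shift j z hz, mul_smul, mul_smul, inv_smul_smul]

theorem hasNormalForm_of_conj {P : SL(2, ℝ)}
    (h : HasNormalForm hs r fun z => ((P • G z : ℍ) : ℂ)) :
    HasNormalForm hs r fun z => (G z : ℂ) := by
  refine h.mobius (α := (P⁻¹ 0 0 : ℝ)) (β := (P⁻¹ 0 1 : ℝ)) (γ := (P⁻¹ 1 0 : ℝ))
    (δ := (P⁻¹ 1 1 : ℝ)) ?_ fun z _ => ?_
  · have := sl_det_eq_one P⁻¹
    have h2 : ((P⁻¹ 0 0 : ℝ) : ℂ) * (P⁻¹ 1 1 : ℝ) - (P⁻¹ 0 1 : ℝ) * (P⁻¹ 1 0 : ℝ) = 1 := by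
      exact_mod_cast this
    rw [h2]; exact one_ne_zero
  · have h1 := coe_sl_smul P⁻¹ (P • G z)
    rwa [inv_smul_smul, eq_div_iff (sl_denom_ne_zero _ _)] at h1

/-- In the disc coordinate `(w - c) / (w - c̄)` centred at the common fixed point, every `M j` is a
rotation, and `elliptic_extension` applies. -/
theorem hasNormalForm_of_fixedPoint (h : MobiusEquivariant r G M) (c : ℍ)
    (hc : ∀ j, M j • c = c) : HasNormalForm hs r fun z => (G z : ℂ) := by
  have hne : ∀ w : ℍ, (w : ℂ) - (starRingEnd ℂ) c ≠ 0 := fun w h0 => by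
    have := congrArg im h0
    simp at this
    linarith [w.im_pos, c.im_pos]
  have hκ : ∀ j, ∃ κ : Circle, ∀ w : ℍ,
      (((M j • w : ℍ) : ℂ) - c) / (((M j • w : ℍ) : ℂ) - (starRingEnd ℂ) c) =
        κ * (((w : ℂ) - c) / ((w : ℂ) - (starRingEnd ℂ) c)) := by
    intro j
    have hd := sl_denom_ne_zero (M j) c
    -- The multiplier is `B̄ / B`, where `B` is the denominator of `M j` at `c`.
    refine ⟨Circle.ofConjDivSelf _ hd, fun w => ?_⟩
    have hdw := sl_denom_ne_zero (M j) w
    have hcj := congrArg UpperHalfPlane.coe (hc j)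
    rw [coe_sl_smul, div_eq_iff hd] at hcj
    have hcj' := congrArg (starRingEnd ℂ) hcj
    simp only [map_add, map_mul, conj_ofReal] at hcj'
    have hdet : (M j 0 0 : ℂ) * M j 1 1 - M j 0 1 * M j 1 0 = 1 := by
      exact_mod_cast sl_det_eq_one (M j)
    have hd' : (M j 1 0 : ℂ) * (starRingEnd ℂ) c + M j 1 1 ≠ 0 := fun h0 => hd (by
      have := congrArg (starRingEnd ℂ) h0
      simpa using this)
    have h1 : ((M j • w : ℍ) : ℂ) - c = (w - c) /
        (((M j 1 0 : ℂ) * w + M j 1 1) * ((M j 1 0 : ℂ) * c + M j 1 1)) := by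
      rw [coe_sl_smul, eq_div_iff (mul_ne_zero hdw hd)]
      have : ((M j 0 0 : ℂ) * w + M j 0 1) / ((M j 1 0 : ℂ) * w + M j 1 1) *
          ((M j 1 0 : ℂ) * w + M j 1 1) = (M j 0 0 : ℂ) * w + M j 0 1 := div_mul_cancel₀ _ hdw
      linear_combination ((M j 1 0 : ℂ) * c + M j 1 1) * this +
        ((w : ℂ) - c) * hdet + ((M j 1 0 : ℂ) * w + M j 1 1) * hcj
    have h2 : ((M j • w : ℍ) : ℂ) - (starRingEnd ℂ) c = (w - (starRingEnd ℂ) c) /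
        (((M j 1 0 : ℂ) * w + M j 1 1) * ((M j 1 0 : ℂ) * (starRingEnd ℂ) c + M j 1 1)) := by
      rw [coe_sl_smul, eq_div_iff (mul_ne_zero hdw hd')]
      have : ((M j 0 0 : ℂ) * w + M j 0 1) / ((M j 1 0 : ℂ) * w + M j 1 1) *
          ((M j 1 0 : ℂ) * w + M j 1 1) = (M j 0 0 : ℂ) * w + M j 0 1 := div_mul_cancel₀ _ hdw
      linear_combination ((M j 1 0 : ℂ) * (starRingEnd ℂ) c + M j 1 1) * this +
        ((w : ℂ) - (starRingEnd ℂ) c) * hdet + ((M j 1 0 : ℂ) * w + M j 1 1) * hcj'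
    have hof : (Circle.ofConjDivSelf _ hd : ℂ) = (starRingEnd ℂ) ((M j 1 0 : ℂ) * c + M j 1 1) /
        ((M j 1 0 : ℂ) * c + M j 1 1) := rfl
    rw [h1, h2, hof]
    simp only [map_add, map_mul, conj_ofReal]
    have := hne w
    generalize (M j 1 0 : ℂ) * w + M j 1 1 = A at hdw ⊢
    generalize (M j 1 0 : ℂ) * c + M j 1 1 = B at hd ⊢
    generalize (M j 1 0 : ℂ) * (starRingEnd ℂ) c + M j 1 1 = B' at hd' ⊢
    field_simp
  choose κ hκ using hκ
  choose ν hν0 hν1 hν using fun j => exists_circle_eq_exp (κ j)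
  obtain ⟨u, hu, huG⟩ := elliptic_extension hs (r := r)
    (G := fun z => ((G z : ℂ) - c) / ((G z : ℂ) - (starRingEnd ℂ) c))
    (by
      simp only [div_eq_mul_inv]
      exact (h.differentiableOn.sub_const _).mul
        ((h.differentiableOn.sub_const _).inv fun z _ => hne (G z)))
    (fun z _ => by
      rw [norm_div, div_le_one (norm_pos_iff.2 (hne _)), ← sq_le_sq₀ (norm_nonneg _) (norm_nonneg _),
        ← normSq_eq_norm_sq, ← normSq_eq_norm_sq]
      simp only [normSq_apply, sub_re, sub_im, conj_re, conj_im, UpperHalfPlane.coe_re,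
        UpperHalfPlane.coe_im]
      nlinarith [mul_pos (G z).im_pos c.im_pos])
    ν hν1 (fun j z hz => by
      rw [h.shift j z hz, hκ, hν])
  -- Coefficients of the inverse coordinate change `w = (-c̄ W + c) / (-W + 1)`.
  refine ⟨-(starRingEnd ℂ) c, c, -1, 1, ?_, u, fun j => ν j, 0, hu, Or.inr rfl, fun z hz => ?_⟩
  · have := hne c
    ring_nf at this ⊢
    exact this
  · have h1 := huG z hz
    have : elementaryForm hs u (fun j => (ν j : ℂ)) 0 z =
        ((G z : ℂ) - c) / ((G z : ℂ) - (starRingEnd ℂ) c) := by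
      simp [elementaryForm, h1]
    rw [this]
    have := hne (G z)
    field_simp
    ring

/-- `M j₀` acts as `w ↦ l w + t`. If `l = 1` it is a nontrivial translation, so all `M j` commuting
with it are translations and `parabolic_extension` applies. If `l ≠ 1` they are all homotheties
about one real point, contradicting `homothety_eq_one`. -/
theorem hasNormalForm_of_upperTriangular (hr : 0 < r) (h : MobiusEquivariant r G M)
    (hcomm : ∀ i j (w : ℍ), M i • M j • w = M j • M i • w) {j₀ : Fin s} (hj₀ : M j₀ 1 0 = 0)
    {w₀ : ℍ} (hw₀ : M j₀ • w₀ ≠ w₀) : HasNormalForm hs r fun z => (G z : ℂ) := by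
  set l := M j₀ 0 0 ^ 2
  set t := M j₀ 0 1 * M j₀ 0 0
  have haff : ∀ w : ℍ, ((M j₀ • w : ℍ) : ℂ) = (l : ℝ) * w + (t : ℝ) := sl_smul_eq_affine hj₀
  have hl0 : 0 < l := by
    have := sl_det_eq_one (M j₀)
    rw [hj₀] at this
    have h00 : M j₀ 0 0 ≠ 0 := fun h0 => by rw [h0] at this; simp at this
    positivity
  by_cases hl : l = 1
  · have ht : t ≠ 0 := fun ht => hw₀ (UpperHalfPlane.ext (by rw [haff, hl, ht]; simp))
    have htr : ∀ j, ∃ a : ℝ, ∀ w : ℍ, ((M j • w : ℍ) : ℂ) = w + a := by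
      intro j
      obtain ⟨h1, h2, h3⟩ := sl_commute_affine haff (hcomm j j₀)
      have hdet := sl_det_eq_one (M j)
      rw [hl] at h1 h2 h3
      have hγ : M j 1 0 = 0 := by
        have : t * (M j 1 0) ^ 2 = 0 := by linarith
        simpa [ht] using this
      rw [hγ] at h3 hdet
      have hαδ : M j 0 0 = M j 1 1 := by
        have hδ : M j 1 1 ≠ 0 := fun h0 => by rw [h0] at hdet; simp at hdet
        have : t * M j 1 1 * (M j 0 0 - M j 1 1) = 0 := by linarith
        simpa [ht, hδ, sub_eq_zero] using this
      refine ⟨M j 0 1 * M j 0 0, fun w => ?_⟩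
      rw [sl_smul_eq_affine hγ]
      have : M j 0 0 ^ 2 = 1 := by rw [← hαδ] at hdet; linarith
      rw [this, ofReal_one, one_mul]
    choose a ha using htr
    obtain ⟨-, g, hg, hgG⟩ := parabolic_extension hs hr h.differentiableOn
      (fun z _ => (G z).im_pos.le) a fun j z hz => by rw [h.shift j z hz, ha]
    refine ⟨1, 0, 0, 1, by simp, g, 0, fun i => 1 / (2 * Real.pi * I) * a i, hg, Or.inl rfl,
      fun z hz => ?_⟩
    beta_reduce
    rw [hgG z hz]
    simp only [elementaryForm, Finset.mul_sum, Pi.zero_apply, zero_mul, Finset.sum_const_zero,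
      exp_zero, mul_one, one_mul, zero_add, add_zero, mul_assoc]
    ring
  · exfalso
    -- The real fixed point of `w ↦ l w + t`; conjugation by `P` moves it to `0`.
    set x₀ : ℝ := t / (1 - l)
    have hx₀ : x₀ * (1 - l) = t := div_mul_cancel₀ _ (sub_ne_zero.2 (Ne.symm hl))
    let P : SL(2, ℝ) := ⟨!![1, -x₀; 0, 1], by simp [Matrix.det_fin_two_of]⟩
    have hP : ∀ w : ℍ, ((P • w : ℍ) : ℂ) = w - x₀ := fun w => by
      rw [coe_sl_smul]; simp [P, sub_eq_add_neg]
    have hPi : ∀ w : ℍ, ((P⁻¹ • w : ℍ) : ℂ) = w + x₀ := fun w => by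
      have := hP (P⁻¹ • w)
      rw [smul_inv_smul] at this
      rw [this]; ring
    have h' := h.conj P
    have haff' : ∀ w : ℍ, (((P * M j₀ * P⁻¹) • w : ℍ) : ℂ) = (l : ℝ) * w + (0 : ℝ) := fun w => by
      rw [mul_smul, mul_smul, hP, haff, hPi]
      have : (x₀ : ℂ) * (1 - l) = t := by exact_mod_cast hx₀
      push_cast
      linear_combination -this
    have hhom : ∀ j, ∃ a : ℝ, 0 < a ∧ ∀ w : ℍ, (((P * M j * P⁻¹) • w : ℍ) : ℂ) = a * w := by
      intro j
      obtain ⟨h1, h2, h3⟩ := sl_commute_affine (g := P * M j * P⁻¹) haff' (fun w => by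
        simp only [mul_smul, inv_smul_smul, hcomm j j₀])
      have hdet := sl_det_eq_one (P * M j * P⁻¹)
      generalize P * M j * P⁻¹ = g at *
      have hl1 : 1 - l ≠ 0 := sub_ne_zero.2 (Ne.symm hl)
      have e2 : g 0 1 * g 1 0 = 0 := by
        have : (1 - l) * (1 + l) * (g 0 1 * g 1 0) = 0 := by linear_combination h2
        simpa [hl1, (by positivity : 1 + l ≠ 0)] using this
      have e1 : g 1 0 = 0 := by
        have : l * (1 - l) * (g 0 0 * g 1 0) = 0 := by linear_combination h1
        have : g 0 0 * g 1 0 = 0 := by simpa [hl1, hl0.ne'] using this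
        have h00 : g 0 0 ≠ 0 := fun h0 => by rw [h0] at hdet; linarith
        simpa [h00] using this
      have e3 : g 0 1 = 0 := by
        have : (1 - l) * (g 0 1 * g 1 1) = 0 := by linear_combination h3
        have : g 0 1 * g 1 1 = 0 := by simpa [hl1] using this
        have h11 : g 1 1 ≠ 0 := fun h0 => by rw [h0] at hdet; linarith
        simpa [h11] using this
      have h00 : g 0 0 ≠ 0 := fun h0 => by rw [h0, e1] at hdet; linarith
      refine ⟨g 0 0 ^ 2, by positivity, fun w => ?_⟩
      rw [sl_smul_eq_affine e1, e3]
      simp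
    choose a ha0 ha using hhom
    have hone := homothety_eq_one hs hr h'.differentiableOn (fun z _ => (P • G z).im_pos) a ha0
      (fun j z hz => by
        have := congrArg UpperHalfPlane.coe (h'.shift j z hz)
        exact this.trans (ha j _)) j₀
    have h3 := (ha j₀ UpperHalfPlane.I).symm.trans (haff' UpperHalfPlane.I)
    rw [hone] at h3
    have h4 : (l : ℂ) = 1 := by
      have := UpperHalfPlane.ne_zero UpperHalfPlane.I
      refine mul_right_cancel₀ this ?_
      simpa using h3.symm
    exact hl (by exact_mod_cast h4)

/-- A nonconstant Möbius-equivariant map with values in the half-plane has a normal form. -/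
theorem hasNormalForm (hr : 0 < r) (h : MobiusEquivariant r G M) {z w : Cn n}
    (hz : z ∈ logDomain n s r) (hw : w ∈ logDomain n s r) (hne : G z ≠ G w) :
    HasNormalForm hs r fun z => (G z : ℂ) := by
  have hcomm : ∀ i j (v : ℍ), M i • M j • v = M j • M i • v := by
    intro i j v
    -- Lattice translations commute, so the `M j` commute on values of `G`; two distinct values give
    -- commutation on all of `ℍ`.
    have key : ∀ z ∈ logDomain n s r, M i • M j • G z = M j • M i • G z := fun z hz => by
      rw [← h.shift j z hz, ← h.shift i z hz, ← h.shift i _ (add_latticeShift_mem hz _),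
        ← h.shift j _ (add_latticeShift_mem hz _), add_right_comm]
    exact sl_commute_of_two_points hne (key z hz) (key w hw) v
  by_cases htriv : ∀ j, M j • UpperHalfPlane.I = UpperHalfPlane.I
  · exact h.hasNormalForm_of_fixedPoint _ htriv
  push Not at htriv
  obtain ⟨j₀, hj₀⟩ := htriv
  by_cases hfix : ∃ c : ℍ, M j₀ • c = c
  · obtain ⟨c, hc⟩ := hfix
    -- `M j • c` is again fixed by `M j₀`, whose fixed point in `ℍ` is unique.
    refine h.hasNormalForm_of_fixedPoint c fun j => sl_fixedPoint_unique hj₀ ?_ hc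
    rw [← hcomm, hc]
  by_cases hγ : M j₀ 1 0 = 0
  · exact h.hasNormalForm_of_upperTriangular hr hcomm hγ hj₀
  -- Without a fixed point in `ℍ` the matrix is not elliptic, so its fixed-point equation has a real
  -- root `x`.
  have hdisc : 0 ≤ (M j₀ 1 1 - M j₀ 0 0) ^ 2 + 4 * M j₀ 0 1 * M j₀ 1 0 := by
    by_contra hneg
    push Not at hneg
    have hell : (M j₀ : GL (Fin 2) ℝ).IsElliptic := by
      change Matrix.discr _ < 0
      rw [Matrix.discr_fin_two, Matrix.trace_fin_two, Matrix.det_fin_two]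
      simp
      linarith
    exact hfix ⟨UpperHalfPlane.fixedPt _ hell,
      (UpperHalfPlane.gl_smul_eq_self_iff_eq_fixedPt (by simp) hell).2 rfl⟩
  set q := √((M j₀ 1 1 - M j₀ 0 0) ^ 2 + 4 * M j₀ 0 1 * M j₀ 1 0)
  have hq : q ^ 2 = (M j₀ 1 1 - M j₀ 0 0) ^ 2 + 4 * M j₀ 0 1 * M j₀ 1 0 := Real.sq_sqrt hdisc
  obtain ⟨x, hx⟩ : ∃ x : ℝ, M j₀ 1 0 * x ^ 2 + (M j₀ 1 1 - M j₀ 0 0) * x - M j₀ 0 1 = 0 := by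
    refine ⟨(M j₀ 0 0 - M j₀ 1 1 + q) / (2 * M j₀ 1 0), ?_⟩
    field_simp
    linear_combination hq
  -- `w ↦ -1 / (w - x)` sends the boundary fixed point to infinity and makes `M j₀` upper
  -- triangular.
  let P : SL(2, ℝ) := ⟨!![0, -1; 1, -x], by simp [Matrix.det_fin_two_of]⟩
  refine hasNormalForm_of_conj (P := P) ?_
  refine (h.conj P).hasNormalForm_of_upperTriangular hr (fun i j v => ?_) (j₀ := j₀) ?_
    (w₀ := P • UpperHalfPlane.I) ?_
  · simp only [mul_smul, inv_smul_smul, hcomm i j]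
  · rw [Matrix.SpecialLinearGroup.coe_mul, Matrix.SpecialLinearGroup.coe_mul,
      Matrix.SpecialLinearGroup.coe_inv, Matrix.adjugate_fin_two]
    simp only [Matrix.mul_apply, Fin.sum_univ_two]
    simp [P]
    linear_combination hx
  · intro h0
    rw [mul_smul, mul_smul, inv_smul_smul] at h0
    exact hj₀ (smul_left_cancel P h0)

end MobiusEquivariant

/-! ### Exterior derivatives of holomorphic forms -/

theorem dForm_congr {n : ℕ} {η η' : Cn n → (Cn n →L[ℂ] ℂ)} {x : Cn n} (h : η =ᶠ[𝓝 x] η')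
    (v w : Cn n) : dForm η x v w = dForm η' x v w := by
  rw [dForm, dForm, h.fderiv_eq]

theorem dForm_eq {n : ℕ} {η : Cn n → (Cn n →L[ℂ] ℂ)} {x : Cn n} (h : DifferentiableAt ℂ η x)
    (v w : Cn n) : dForm η x v w =
      fderiv ℂ (fun y => η y w) x v - fderiv ℂ (fun y => η y v) x w := by
  have key : ∀ v w, fderiv ℂ η x v w = fderiv ℂ (fun y => η y w) x v := fun v w => by
    rw [(h.hasFDerivAt.clm_apply (hasFDerivAt_const w x)).fderiv]
    simp
  rw [dForm, key, key]

theorem dForm_smul_fderiv {n : ℕ} {U : Set (Cn n)} (hU : IsOpen U) {f W : Cn n → ℂ}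
    (hW : DifferentiableOn ℂ W U) {x : Cn n} (hx : x ∈ U) (hf : DifferentiableAt ℂ f x)
    (v w : Cn n) : dForm (fun y => f y • fderiv ℂ W y) x v w =
      fderiv ℂ f x v * fderiv ℂ W x w - fderiv ℂ f x w * fderiv ℂ W x v := by
  have h := hf.hasFDerivAt.smul
    ((differentiableOn_fderiv hU hW).differentiableAt (hU.mem_nhds hx)).hasFDerivAt
  have h2 := fderiv_fderiv_apply_comm hU hW hx v w
  rw [dForm, show (fun y => f y • fderiv ℂ W y) = f • fderiv ℂ W from rfl, h.fderiv]
  simp [h2]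

theorem dForm_fderiv {n : ℕ} {U : Set (Cn n)} (hU : IsOpen U) {W : Cn n → ℂ}
    (hW : DifferentiableOn ℂ W U) {x : Cn n} (hx : x ∈ U) (v w : Cn n) :
    dForm (fderiv ℂ W) x v w = 0 := by
  rw [dForm, fderiv_fderiv_apply_comm hU hW hx, sub_self]

section

variable {n s : ℕ} (hs : s ≤ n) {r : ℝ}

/-- One-variable identity theorem on the complex line through `z₀` and `z`, whose trace on the
convex domain is convex, hence connected. -/
theorem eqOn_const_of_eventuallyEq_logDomain {F : Cn n → ℂ}
    (hF : DifferentiableOn ℂ F (logDomain n s r)) {z₀ : Cn n} (hz₀ : z₀ ∈ logDomain n s r) {c : ℂ}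
    (h : ∀ᶠ z in 𝓝 z₀, F z = c) {z : Cn n} (hz : z ∈ logDomain n s r) : F z = c := by
  have hcont : Continuous fun t : ℂ => z₀ + t • (z - z₀) := by fun_prop
  set A : Set ℂ := (fun t : ℂ => z₀ + t • (z - z₀)) ⁻¹' logDomain n s r
  have hA : IsOpen A := isOpen_logDomain.preimage hcont
  have hconv : Convex ℝ A := by
    intro t ht t' ht' a b ha hb hab
    have h1 := convex_logDomain (n := n) (s := s) (r := r) ht ht' ha hb hab
    have h2 : z₀ + (a • t + b • t') • (z - z₀) =
        a • (z₀ + t • (z - z₀)) + b • (z₀ + t' • (z - z₀)) := by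
      have : z₀ = a • z₀ + b • z₀ := by rw [← add_smul, hab, one_smul]
      rw [smul_add, smul_add, add_smul, smul_assoc, smul_assoc]
      nth_rw 1 [this]
      abel
    rw [mem_preimage, h2]
    exact h1
  have hf : DifferentiableOn ℂ (fun t : ℂ => F (z₀ + t • (z - z₀))) A :=
    hF.comp (by fun_prop) fun t ht => ht
  have h0 : (0 : ℂ) ∈ A := by simpa [A] using hz₀
  have h1 : (1 : ℂ) ∈ A := by simpa [A] using hz
  have key := (hf.analyticOnNhd hA).eqOn_of_preconnected_of_eventuallyEq
    (analyticOnNhd_const (v := c)) hconv.isPreconnected h0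
    ((hcont.tendsto' 0 z₀ (by simp)).eventually h) h1
  simpa using key

/-! ### Logarithmic forms -/

/-- The function `x₁ ⋯ x_s`. -/
def coordProd (x : Cn n) : ℂ := ∏ j : Fin s, x (Fin.castLE hs j)

/-- The logarithmic form `∑ c_j dx_j / x_j`. -/
noncomputable def logForm (c : Fin s → ℂ) (x : Cn n) : Cn n →L[ℂ] ℂ :=
  ∑ j, (c j / x (Fin.castLE hs j)) • EuclideanSpace.proj (Fin.castLE hs j)

/-- The holomorphic form `x₁ ⋯ x_s ∑ c_j dx_j / x_j`. -/
noncomputable def polarForm (c : Fin s → ℂ) (x : Cn n) : Cn n →L[ℂ] ℂ :=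
  ∑ j, (c j * ∏ k ∈ Finset.univ.erase j, x (Fin.castLE hs k)) • EuclideanSpace.proj (Fin.castLE hs j)

theorem differentiable_coordProd : Differentiable ℂ (coordProd hs) := by
  unfold coordProd
  fun_prop

theorem differentiable_polarForm (c : Fin s → ℂ) : Differentiable ℂ (polarForm hs c) := by
  unfold polarForm
  fun_prop

theorem coordProd_ne_zero_iff {x : Cn n} :
    coordProd hs x ≠ 0 ↔ ∀ j : Fin s, x (Fin.castLE hs j) ≠ 0 := by
  simp [coordProd, Finset.prod_ne_zero_iff]

theorem polarForm_eq {c : Fin s → ℂ} {x : Cn n} (hx : ∀ j : Fin s, x (Fin.castLE hs j) ≠ 0) :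
    polarForm hs c x = coordProd hs x • logForm hs c x := by
  rw [polarForm, logForm, Finset.smul_sum]
  refine Finset.sum_congr rfl fun j _ => ?_
  rw [smul_smul, coordProd, ← Finset.mul_prod_erase _ _ (Finset.mem_univ j)]
  congr 1
  have := hx j
  field_simp

/-- Differentiate `exp (ψ_j) = x_j`. Allowing any holomorphic right inverse `ψ` of `expCoord` covers
both `logCoord` and the branches coming from sections of `p`. -/
theorem hasFDerivAt_sum_log {U : Set (Cn n)} (hU : IsOpen U) {ψ : Cn n → Cn n}
    (hψ : DifferentiableOn ℂ ψ U) (hexp : ∀ y ∈ U, expCoord s (ψ y) = y) (c : Fin s → ℂ) {x : Cn n}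
    (hx : x ∈ U) :
    HasFDerivAt (fun y => ∑ j, c j * ψ y (Fin.castLE hs j)) (logForm hs c x) x := by
  refine HasFDerivAt.fun_sum fun j _ => ?_
  have hd : DifferentiableAt ℂ (fun y => ψ y (Fin.castLE hs j)) x :=
    differentiableAt_euclidean.1 (hψ.differentiableAt (hU.mem_nhds hx)) _
  have h1 := hd.hasFDerivAt.cexp
  have h2 : HasFDerivAt (fun y : Cn n => exp (ψ y (Fin.castLE hs j)))
      (EuclideanSpace.proj (Fin.castLE hs j) : Cn n →L[ℂ] ℂ) x := by
    refine (EuclideanSpace.proj (Fin.castLE hs j) : Cn n →L[ℂ] ℂ).hasFDerivAt.congr_of_eventuallyEq ?_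
    filter_upwards [hU.mem_nhds hx] with y hy
    rw [← expCoord_apply_castLE, hexp y hy]
    rfl
  have h3 := h1.unique h2
  have hxj : exp (ψ x (Fin.castLE hs j)) = x (Fin.castLE hs j) := by
    rw [← expCoord_apply_castLE, hexp x hx]
  have h4 : (c j / x (Fin.castLE hs j)) • (EuclideanSpace.proj (Fin.castLE hs j) : Cn n →L[ℂ] ℂ) =
      c j • fderiv ℂ (fun y => ψ y (Fin.castLE hs j)) x := by
    rw [← h3, ← hxj, smul_smul, div_mul_cancel₀ _ (exp_ne_zero _)]
  rw [h4]
  exact hd.hasFDerivAt.const_mul (c j)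

theorem differentiableOn_sum_log {U : Set (Cn n)} (hU : IsOpen U) {ψ : Cn n → Cn n}
    (hψ : DifferentiableOn ℂ ψ U) (hexp : ∀ y ∈ U, expCoord s (ψ y) = y) (c : Fin s → ℂ) :
    DifferentiableOn ℂ (fun y => ∑ j, c j * ψ y (Fin.castLE hs j)) U := fun _ hx =>
  (hasFDerivAt_sum_log hs hU hψ hexp c hx).differentiableAt.differentiableWithinAt

theorem dForm_logForm (c : Fin s → ℂ) {x : Cn n} (hx : x ∈ ballCompl n s hs r) (v w : Cn n) :
    dForm (logForm hs c) x v w = 0 := by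
  obtain ⟨z₀, hz₀, rfl⟩ := exists_expCoord_eq hs hx
  obtain ⟨U, hU, hxU, hUX, hd, -⟩ := exists_logCoord_nhds hs hz₀
  have hexp : ∀ y ∈ U, expCoord s (logCoord s z₀ y) = y := fun y hy =>
    expCoord_logCoord hs z₀ (hUX hy).2
  rw [dForm_congr (η' := fderiv ℂ fun y => ∑ j, c j * logCoord s z₀ y (Fin.castLE hs j))]
  · exact dForm_fderiv hU (differentiableOn_sum_log hs hU hd hexp c) hxU v w
  · filter_upwards [hU.mem_nhds hxU] with y hy
    exact (hasFDerivAt_sum_log hs hU hd hexp c hy).fderiv.symm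

/-- The holomorphic form `x₁ ⋯ x_s (du + u ∑ ν_j dx_j / x_j + ∑ μ_j dx_j / x_j)`. -/
noncomputable def foliationForm (u : Cn n → ℂ) (ν μ : Fin s → ℂ) (x : Cn n) : Cn n →L[ℂ] ℂ :=
  coordProd hs x • fderiv ℂ u x + u x • polarForm hs ν x + polarForm hs μ x

variable {u : Cn n → ℂ} {ν μ : Fin s → ℂ}

theorem differentiableOn_foliationForm (hu : DifferentiableOn ℂ u (ball 0 r)) :
    DifferentiableOn ℂ (foliationForm hs u ν μ) (ball 0 r) :=
  (((differentiable_coordProd hs).differentiableOn.smul (differentiableOn_fderiv isOpen_ball hu)).add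
    (hu.smul (differentiable_polarForm hs ν).differentiableOn)).add
    (differentiable_polarForm hs μ).differentiableOn

theorem foliationForm_eq {x : Cn n} (hx : ∀ j : Fin s, x (Fin.castLE hs j) ≠ 0) :
    foliationForm hs u ν μ x =
      coordProd hs x • (fderiv ℂ u x + u x • logForm hs ν x + logForm hs μ x) := by
  rw [foliationForm, polarForm_eq hs hx, polarForm_eq hs hx]
  module

/-- This is where the alternative between elliptic and parabolic matters: it lets the exponential be
factored out of all of `dW`. -/
theorem exp_smul_logForm (hνμ : ν = 0 ∨ μ = 0) (z x : Cn n) :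
    exp (∑ i, ν i * z (Fin.castLE hs i)) • logForm hs μ x = logForm hs μ x := by
  rcases hνμ with rfl | rfl
  · simp
  · ext v
    simp [logForm]

/-- All multivaluedness of `dW` sits in a nonvanishing scalar factor, so its kernel is that of a
form defined on the whole ball. -/
theorem hasFDerivAt_elementaryForm (hu : DifferentiableOn ℂ u (ball 0 r)) (hνμ : ν = 0 ∨ μ = 0)
    {U : Set (Cn n)} (hU : IsOpen U) (hUX : U ⊆ ballCompl n s hs r) {ψ : Cn n → Cn n}
    (hψ : DifferentiableOn ℂ ψ U) (hexp : ∀ y ∈ U, expCoord s (ψ y) = y) {x : Cn n} (hx : x ∈ U) :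
    HasFDerivAt (fun y => elementaryForm hs u ν μ (ψ y))
      ((exp (∑ i, ν i * ψ x (Fin.castLE hs i)) / coordProd hs x) • foliationForm hs u ν μ x) x := by
  have hux := (hu.differentiableAt (isOpen_ball.mem_nhds (hUX hx).1)).hasFDerivAt
  have h := (hux.mul (hasFDerivAt_sum_log hs hU hψ hexp ν hx).cexp).add
    (hasFDerivAt_sum_log hs hU hψ hexp μ hx)
  have hP := (coordProd_ne_zero_iff hs).2 (hUX hx).2
  have h1 : (exp (∑ i, ν i * ψ x (Fin.castLE hs i)) / coordProd hs x) • foliationForm hs u ν μ x =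
      u x • (exp (∑ i, ν i * ψ x (Fin.castLE hs i)) • logForm hs ν x) +
        exp (∑ i, ν i * ψ x (Fin.castLE hs i)) • fderiv ℂ u x + logForm hs μ x := by
    rw [foliationForm_eq hs (hUX hx).2, smul_smul, div_mul_cancel₀ _ hP, smul_add, smul_add,
      exp_smul_logForm hs hνμ]
    module
  rw [h1]
  refine h.congr_of_eventuallyEq ?_
  filter_upwards [hU.mem_nhds hx] with y hy
  simp [elementaryForm, hexp y hy]

/-- Off the hyperplanes the form is locally `f dW`, for which `ω ∧ dω = 0`; the identity extends by
continuity and density. -/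
theorem foliationForm_integrable (hu : DifferentiableOn ℂ u (ball 0 r)) (hνμ : ν = 0 ∨ μ = 0)
    {x : Cn n} (hx : x ∈ ball (0 : Cn n) r) (a b c : Cn n) :
    foliationForm hs u ν μ x a * dForm (foliationForm hs u ν μ) x b c +
      foliationForm hs u ν μ x b * dForm (foliationForm hs u ν μ) x c a +
      foliationForm hs u ν μ x c * dForm (foliationForm hs u ν μ) x a b = 0 := by
  set ω := foliationForm hs u ν μ
  have hω : DifferentiableOn ℂ ω (ball 0 r) := differentiableOn_foliationForm hs hu
  have hωa : ∀ v, DifferentiableOn ℂ (fun y => ω y v) (ball 0 r) := fun v =>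
    hω.clm_apply (differentiableOn_const v)
  have hdc : ∀ v w, ContinuousOn (fun y => dForm ω y v w) (ball 0 r) := by
    intro v w
    refine (((differentiableOn_fderiv_apply isOpen_ball (hωa w) v).continuousOn).sub
      (differentiableOn_fderiv_apply isOpen_ball (hωa v) w).continuousOn).congr fun y hy => ?_
    exact dForm_eq (hω.differentiableAt (isOpen_ball.mem_nhds hy)) v w
  have hcont : ContinuousOn (fun y => ω y a * dForm ω y b c + ω y b * dForm ω y c a +
      ω y c * dForm ω y a b) (ball 0 r) :=
    (((hωa a).continuousOn.mul (hdc b c)).add ((hωa b).continuousOn.mul (hdc c a))).add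
      ((hωa c).continuousOn.mul (hdc a b))
  refine eq_of_eventually_eq_nhdsWithin (x := x) (f := fun y => ω y a * dForm ω y b c +
      ω y b * dForm ω y c a + ω y c * dForm ω y a b) (g := fun _ => (0 : ℂ)) (S := ballCompl n s hs r)
    (hcont.continuousAt (isOpen_ball.mem_nhds hx)) continuousAt_const
    (mem_closure_iff_nhdsWithin_neBot.2 (nhdsWithin_ballCompl_neBot hs hx)) ?_
  filter_upwards [self_mem_nhdsWithin] with y hy
  obtain ⟨z₀, hz₀, rfl⟩ := exists_expCoord_eq hs hy
  obtain ⟨U, hU, hyU, hUX, hd, -⟩ := exists_logCoord_nhds hs hz₀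
  have hexp : ∀ y ∈ U, expCoord s (logCoord s z₀ y) = y := fun y hy =>
    expCoord_logCoord hs z₀ (hUX hy).2
  have hW := fun x hx => hasFDerivAt_elementaryForm hs (x := x) hu hνμ hU hUX hd hexp hx
  set f : Cn n → ℂ := fun y =>
    coordProd hs y * exp (-∑ i, ν i * logCoord s z₀ y (Fin.castLE hs i))
  set W : Cn n → ℂ := fun y => elementaryForm hs u ν μ (logCoord s z₀ y)
  have hωW : ∀ y ∈ U, ω y = f y • fderiv ℂ W y := by
    intro y hy
    have hP := (coordProd_ne_zero_iff hs).2 (hUX hy).2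
    rw [(hW y hy).fderiv, smul_smul]
    have : f y * (exp (∑ i, ν i * logCoord s z₀ y (Fin.castLE hs i)) / coordProd hs y) = 1 := by
      simp only [f]
      rw [exp_neg]
      have := exp_ne_zero (∑ i, ν i * logCoord s z₀ y (Fin.castLE hs i))
      field_simp
    rw [this, one_smul]
  have hf : DifferentiableOn ℂ f U := (differentiable_coordProd hs).differentiableOn.mul
    (differentiableOn_sum_log hs hU hd hexp ν).neg.cexp
  have hWd : DifferentiableOn ℂ W U := fun x hx => (hW x hx).differentiableAt.differentiableWithinAt
  have hdω : ∀ v w, dForm ω (expCoord s z₀) v w = _ := fun v w =>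
    (dForm_congr (η' := fun y => f y • fderiv ℂ W y) (by
      filter_upwards [hU.mem_nhds hyU] with y hy using hωW y hy) v w).trans
      (dForm_smul_fderiv hU hWd hyU (hf.differentiableAt (hU.mem_nhds hyU)) v w)
  simp only [hdω, hωW _ hyU, _root_.smul_apply, smul_eq_mul]
  ring

end

/-! ### The Riccati connection of an elementary form. -/

section

variable {n s : ℕ} (hs : s ≤ n) {r : ℝ}

theorem isOpen_ball_inter_ballCompl_nonempty {U : Set (Cn n)} (hU : IsOpen U) (hne : U.Nonempty)
    (hUX : U ⊆ ball (0 : Cn n) r) : (U ∩ ballCompl n s hs r).Nonempty := by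
  obtain ⟨x, hx⟩ := hne
  have := nhdsWithin_ballCompl_neBot hs (hUX hx)
  obtain ⟨y, hy⟩ := Filter.nonempty_of_mem
    (inter_mem (mem_nhdsWithin_of_mem_nhds (hU.mem_nhds hx)) (self_mem_nhdsWithin (a := x)
      (s := ballCompl n s hs r)))
  exact ⟨y, hy⟩

theorem inv_coordProd_smul_polarForm (c : Fin s → ℂ) {x : Cn n} (hx : coordProd hs x ≠ 0) :
    (coordProd hs x)⁻¹ • polarForm hs c x = logForm hs c x := by
  rw [polarForm_eq hs ((coordProd_ne_zero_iff hs).1 hx), smul_smul, inv_mul_cancel₀ hx, one_smul]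

/-- The connection `d + [[∑ ν_j dx_j / x_j, ∑ μ_j dx_j / x_j], [0, 0]]` with the section `[u : 1]`. -/
noncomputable def elementaryTriple {u : Cn n → ℂ} {ν μ : Fin s → ℂ}
    (hu : DifferentiableOn ℂ u (ball 0 r)) (hνμ : ν = 0 ∨ μ = 0) :
    ProjectiveTriple (ball (0 : Cn n) r) where
  q := coordProd hs
  B := ![![polarForm hs ν, polarForm hs μ], ![0, 0]]
  σ x := ![u x, 1]
  q_holomorphic := (differentiable_coordProd hs).differentiableOn
  B_holomorphic := by
    simp only [Fin.forall_fin_two]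
    exact ⟨⟨(differentiable_polarForm hs ν).differentiableOn,
      (differentiable_polarForm hs μ).differentiableOn⟩,
      differentiableOn_const _, differentiableOn_const _⟩
  σ_holomorphic := by
    refine differentiableOn_pi.2 (Fin.forall_fin_two.2 ⟨hu, differentiableOn_const _⟩)
  q_nonzero := fun U hU hne hUX => by
    obtain ⟨x, hxU, hx⟩ := isOpen_ball_inter_ballCompl_nonempty hs hU hne hUX
    exact ⟨x, hxU, (coordProd_ne_zero_iff hs).2 hx.2⟩
  σ_nonzero := fun U _ ⟨x, hx⟩ _ => ⟨x, hx, fun h => one_ne_zero (congrFun h 1)⟩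
  flat := by
    intro x hx hq i j v w
    have hlog : ∀ c : Fin s → ℂ,
        dForm (fun y => (coordProd hs y)⁻¹ • polarForm hs c y) x v w = 0 := fun c => by
      rw [← dForm_logForm (r := r) hs c ⟨hx, (coordProd_ne_zero_iff hs).1 hq⟩ v w]
      refine dForm_congr ?_ v w
      filter_upwards [(differentiable_coordProd hs).continuous.continuousAt.eventually_ne hq]
        with y hy using inv_coordProd_smul_polarForm hs c hy
    have hzero : dForm (fun y => (coordProd hs y)⁻¹ • (0 : Cn n →L[ℂ] ℂ)) x v w = 0 := by
      have : (fun y => (coordProd hs y)⁻¹ • (0 : Cn n →L[ℂ] ℂ)) = fun _ => 0 := by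
        ext; simp
      rw [this, dForm]
      simp
    -- The only possibly nonzero entry of `A ∧ A` is the wedge of the two logarithmic forms, one of
    -- which is zero.
    have hprod : ((coordProd hs x)⁻¹ • polarForm hs ν x) v *
        ((coordProd hs x)⁻¹ • polarForm hs μ x) w -
        ((coordProd hs x)⁻¹ • polarForm hs ν x) w *
          ((coordProd hs x)⁻¹ • polarForm hs μ x) v = 0 := by
      rw [inv_coordProd_smul_polarForm hs _ hq, inv_coordProd_smul_polarForm hs _ hq]
      rcases hνμ with rfl | rfl <;> simp [logForm]
    fin_cases i <;> fin_cases j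
    · refine (congrArg₂ (· + ·) (hlog ν) ?_).trans (add_zero 0)
      simp [Fin.sum_univ_two, mul_comm]
    · refine (congrArg₂ (· + ·) (hlog μ) ?_).trans (add_zero 0)
      rw [Fin.sum_univ_two]
      refine (congrArg₂ (· + ·) hprod ?_).trans (add_zero 0)
      simp
    · refine (congrArg₂ (· + ·) hzero ?_).trans (add_zero 0)
      simp [Fin.sum_univ_two]
    · refine (congrArg₂ (· + ·) hzero ?_).trans (add_zero 0)
      simp [Fin.sum_univ_two]

variable {u : Cn n → ℂ} {ν μ : Fin s → ℂ} (hu : DifferentiableOn ℂ u (ball 0 r))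
  (hνμ : ν = 0 ∨ μ = 0)

theorem elementaryTriple_A {x : Cn n} (hx : coordProd hs x ≠ 0) :
    (elementaryTriple hs hu hνμ).A 0 0 x = logForm hs ν x ∧
    (elementaryTriple hs hu hνμ).A 0 1 x = logForm hs μ x ∧
    (elementaryTriple hs hu hνμ).A 1 0 x = 0 ∧ (elementaryTriple hs hu hνμ).A 1 1 x = 0 :=
  ⟨inv_coordProd_smul_polarForm hs ν hx, inv_coordProd_smul_polarForm hs μ hx,
    ContinuousLinearMap.ext fun _ => mul_zero (coordProd hs x)⁻¹,
    ContinuousLinearMap.ext fun _ => mul_zero (coordProd hs x)⁻¹⟩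

/-- For `σ = (u, 1)` the covariant derivative is `(du + u ∑ ν_j dx_j / x_j + ∑ μ_j dx_j / x_j, 0)`.
-/
theorem riccatiForm_elementaryTriple {x : Cn n} (hxr : x ∈ ball (0 : Cn n) r)
    (hx : coordProd hs x ≠ 0) (v : Cn n) :
    (elementaryTriple hs hu hνμ).riccatiForm x v =
      -((coordProd hs x)⁻¹ * foliationForm hs u ν μ x v) := by
  have hσ : HasFDerivAt (elementaryTriple hs hu hνμ).σ
      (ContinuousLinearMap.pi ![fderiv ℂ u x, 0]) x :=
    hasFDerivAt_pi.2 (Fin.forall_fin_two.2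
      ⟨(hu.differentiableAt (isOpen_ball.mem_nhds hxr)).hasFDerivAt, hasFDerivAt_const 1 x⟩)
  obtain ⟨h00, h01, h10, h11⟩ := elementaryTriple_A hs hu hνμ hx
  have h0 : (elementaryTriple hs hu hνμ).σ x 0 = u x := rfl
  have h1 : (elementaryTriple hs hu hνμ).σ x 1 = 1 := rfl
  simp only [ProjectiveTriple.riccatiForm, ProjectiveTriple.covDeriv, hσ.fderiv, Fin.sum_univ_two,
    h00, h01, h10, h11, h0, h1, foliationForm_eq hs ((coordProd_ne_zero_iff hs).1 hx)]
  rw [smul_apply, smul_eq_mul, inv_mul_cancel_left₀ hx]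
  simp
  ring

end

/-! ### Developing map, foliation and conclusion. -/

namespace Uniformization

variable {n s : ℕ} {hs : s ≤ n} {r : ℝ} {E : Type*} [TopologicalSpace E]
  {p : E → ballCompl n s hs r} (S : Uniformization p) {D : E → 𝔻}

theorem expCoord_section {U : Set (Cn n)} {φ : Cn n → E} (hφ : IsLocalSection p U φ) :
    ∀ y ∈ U, expCoord s (S.Λ (φ y)) = y := fun y hy => by
  rw [S.expCoord_Λ, hφ.2.2 y hy]

theorem _root_.IsLocalSection.subset {U : Set (Cn n)} {φ : Cn n → E} (hφ : IsLocalSection p U φ) :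
    U ⊆ ballCompl n s hs r := fun y hy => hφ.2.2 y hy ▸ (p (φ y)).2

/-- `Λ ∘ φ` is a continuous right inverse of `expCoord`, so it agrees locally with the holomorphic
`logCoord`. -/
theorem differentiableOn_section {U : Set (Cn n)} {φ : Cn n → E} (hφ : IsLocalSection p U φ) :
    DifferentiableOn ℂ (fun y => S.Λ (φ y)) U := by
  intro x hx
  refine DifferentiableAt.differentiableWithinAt ?_
  have hexp := S.expCoord_section hφ
  obtain ⟨V, hV, hxV, -, hd, -⟩ := exists_logCoord_nhds hs (S.mem (φ x))
  rw [hexp x hx] at hxV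
  refine (hd.differentiableAt (hV.mem_nhds hxV)).congr_of_eventuallyEq ?_
  have hc : ContinuousAt (fun y => S.Λ (φ y)) x :=
    S.continuous_Λ.continuousAt.comp (hφ.2.1.continuousAt (hφ.1.mem_nhds hx))
  filter_upwards [hc.eventually (logCoord_expCoord_eventuallyEq (s := s) (S.Λ (φ x))),
    hφ.1.mem_nhds hx] with y hy hyU
  rw [hexp y hyU] at hy
  exact hy.symm

theorem isLocalSection_logCoord {U : Set (Cn n)} (hU : IsOpen U) {z₀ : Cn n}
    (hUX : U ⊆ ballCompl n s hs r) (hd : DifferentiableOn ℂ (logCoord s z₀) U)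
    (hmaps : MapsTo (logCoord s z₀) U (logDomain n s r)) :
    IsLocalSection p U fun x => S.Q (logCoord s z₀ x) :=
  ⟨hU, S.continuousOn_Q.comp hd.continuousOn hmaps, fun x hx => by
    rw [S.p_Q (hmaps hx), expCoord_logCoord hs z₀ (hUX hx).2]⟩

theorem hasNormalForm [PathConnectedSpace E] {e₀ : E}
    {ρ : FundamentalGroup (ballCompl n s hs r) (p e₀) →* DiscAut} (hr : 0 < r) (hp : Continuous p)
    (hD : IsHolomorphicOnCover p fun e => (D e : ℂ)) (hequiv : IsEquivariant p e₀ ρ D)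
    (hne : ¬ ∃ c, ∀ e, D e = c) : HasNormalForm hs r fun z => (D (S.Q z) : ℂ) := by
  choose γ hγ using fun j : Fin s => S.exists_rho_of_shift hp hequiv (Pi.single j 1)
  choose M hM using fun j : Fin s => exists_sl_smul_cayley (ρ (γ j))
  have hG : MobiusEquivariant r (fun z => cayley (D (S.Q z))) M :=
    ⟨S.differentiableOn_biholomorphism_comp isBiholomorphism_cayley hD, fun j z hz => by
      rw [hγ j z hz, hM]⟩
  obtain ⟨e, he⟩ : ∃ e, D e ≠ D e₀ := by
    by_contra! h
    exact hne ⟨_, h⟩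
  -- The coefficients are those of the inverse Cayley transform `(w - I) / (w + I)`.
  refine (hG.hasNormalForm (hs := hs) hr (S.mem e) (S.mem e₀) ?_).mobius
    (α := 1) (β := -I) (γ := 1) (δ := I) ?_ fun z _ => ?_
  · simpa [S.Q_Λ] using he
  · simp
  · have h1 := coe_cayley_symm (cayley (D (S.Q z)))
    rw [Equiv.symm_apply_apply, eq_div_iff (cayley (D (S.Q z))).add_I_ne_zero] at h1
    rw [one_mul, h1]
    ring

section

variable {a b c d : ℂ} {u : Cn n → ℂ} {ν μ : Fin s → ℂ}

/-- The flat frame is `Φ = [[a, b], [c, d]] · [[N, m], [0, 1]]` with `N = exp (∑ ν_j log x_j)` and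
`m = ∑ μ_j log x_j`; applied to `(u, 1)` it gives `(aW + b, cW + d)`. -/
theorem isDevelopingMap (hu : DifferentiableOn ℂ u (ball 0 r)) (hνμ : ν = 0 ∨ μ = 0)
    (hF : ∀ e, (D e : ℂ) * (c * elementaryForm hs u ν μ (S.Λ e) + d) =
      a * elementaryForm hs u ν μ (S.Λ e) + b) (hN : a * d - b * c ≠ 0) :
    (elementaryTriple hs hu hνμ).IsDevelopingMap p fun e => (D e : ℂ) := by
  let N : E → ℂ := fun e => exp (∑ j, ν j * S.Λ e (Fin.castLE hs j))
  let m : E → ℂ := fun e => ∑ j, μ j * S.Λ e (Fin.castLE hs j)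
  have hderiv : ∀ {U : Set (Cn n)} {φ : Cn n → E}, IsLocalSection p U φ → ∀ x ∈ U,
      ∀ α β : ℂ, HasFDerivAt (fun y => α * N (φ y)) ((α * N (φ x)) • logForm hs ν x) x ∧
        HasFDerivAt (fun y => α * m (φ y) + β) ((α * N (φ x)) • logForm hs μ x) x := by
    intro U φ hφ x hx α β
    have h := fun c => hasFDerivAt_sum_log hs hφ.1 (S.differentiableOn_section hφ)
      (S.expCoord_section hφ) c hx
    refine ⟨?_, ?_⟩
    · rw [mul_smul]
      exact (h ν).cexp.const_mul α
    · rw [mul_smul, exp_smul_logForm hs hνμ]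
      exact ((h μ).const_mul α).add_const β
  refine ⟨fun e => !![a * N e, a * m e + b; c * N e, c * m e + d], fun e => ?_, ?_, ?_, fun e => ?_⟩
  · rw [Matrix.det_fin_two_of]
    have : a * N e * (c * m e + d) - (a * m e + b) * (c * N e) = N e * (a * d - b * c) := by ring
    rw [this]
    exact mul_ne_zero (exp_ne_zero _) hN
  · have key : ∀ α β : ℂ, IsHolomorphicOnCover p (fun e => α * N e) ∧
        IsHolomorphicOnCover p (fun e => α * m e + β) := fun α β =>
      ⟨fun U φ hφ x hx => (hderiv hφ x hx α β).1.differentiableAt.differentiableWithinAt,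
        fun U φ hφ x hx => (hderiv hφ x hx α β).2.differentiableAt.differentiableWithinAt⟩
    simp only [Fin.forall_fin_two]
    exact ⟨key a b, key c d⟩
  · intro U φ hφ x hx v
    obtain ⟨h00, h01, h10, h11⟩ := elementaryTriple_A hs hu hνμ
      ((coordProd_ne_zero_iff hs).2 (hφ.subset hx).2)
    have key : ∀ α β : ℂ,
        fderiv ℂ (fun y => α * N (φ y)) x v = α * N (φ x) * logForm hs ν x v +
          (α * m (φ x) + β) * (0 : Cn n →L[ℂ] ℂ) v ∧
        fderiv ℂ (fun y => α * m (φ y) + β) x v = α * N (φ x) * logForm hs μ x v +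
          (α * m (φ x) + β) * (0 : Cn n →L[ℂ] ℂ) v := fun α β => by
      obtain ⟨h1, h2⟩ := hderiv hφ x hx α β
      rw [h1.fderiv, h2.fderiv]
      simp
    simp only [Fin.forall_fin_two, Fin.sum_univ_two, h00, h01, h10, h11]
    exact ⟨key a b, key c d⟩
  · have h := hF e
    rw [elementaryForm, S.expCoord_Λ] at h
    have h0 : (elementaryTriple hs hu hνμ).σ (p e) 0 = u (p e) := rfl
    have h1 : (elementaryTriple hs hu hνμ).σ (p e) 1 = 1 := rfl
    simp only [Matrix.mulVec, dotProduct, Fin.sum_univ_two, h0, h1]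
    change a * N e * u (p e) + (a * m e + b) * 1 =
      D e * (c * N e * u (p e) + (c * m e + d) * 1)
    linear_combination -h

/-- Differentiating `D (cW + d) = aW + b` gives `(cW + d) dD = (a - cD) dW`. Since `(a - cD)(cW + d)
= ad - bc`, both factors are nonzero. -/
theorem fderiv_section_eq_zero_iff (hN : a * d - b * c ≠ 0)
    (hu : DifferentiableOn ℂ u (ball 0 r)) (hνμ : ν = 0 ∨ μ = 0)
    (hD : IsHolomorphicOnCover p fun e => (D e : ℂ))
    (hF : ∀ e, (D e : ℂ) * (c * elementaryForm hs u ν μ (S.Λ e) + d) =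
      a * elementaryForm hs u ν μ (S.Λ e) + b)
    {U : Set (Cn n)} {φ : Cn n → E} (hφ : IsLocalSection p U φ) {x : Cn n} (hx : x ∈ U) (v : Cn n) :
    fderiv ℂ (fun y => (D (φ y) : ℂ)) x v = 0 ↔ foliationForm hs u ν μ x v = 0 := by
  have hf := ((hD U φ hφ).differentiableAt (hφ.1.mem_nhds hx)).hasFDerivAt
  have hW := hasFDerivAt_elementaryForm hs hu hνμ hφ.1 hφ.subset (S.differentiableOn_section hφ)
    (S.expCoord_section hφ) hx
  set W : Cn n → ℂ := fun y => elementaryForm hs u ν μ (S.Λ (φ y))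
  set k := exp (∑ i, ν i * S.Λ (φ x) (Fin.castLE hs i)) / coordProd hs x
  have hk : k ≠ 0 :=
    div_ne_zero (exp_ne_zero _) ((coordProd_ne_zero_iff hs).2 (hφ.subset hx).2)
  have h1 := hf.mul ((hW.const_mul c).add_const d)
  have h2 := (hW.const_mul a).add_const b
  have h3 := h1.unique (h2.congr_of_eventuallyEq (Eventually.of_forall fun y => hF (φ y)))
  have h4 := congrArg (fun L => L v) h3
  simp only [add_apply, smul_apply, smul_eq_mul] at h4
  have h5 : (D (φ x) : ℂ) * (c * W x + d) = a * W x + b := hF (φ x)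
  have h6 : (a - c * D (φ x)) * (c * W x + d) = a * d - b * c := by
    linear_combination -c * h5
  rw [← h6] at hN
  have h7 : (c * W x + d) * fderiv ℂ (fun y => (D (φ y) : ℂ)) x v =
      (a - c * D (φ x)) * (k * foliationForm hs u ν μ x v) := by
    linear_combination h4
  constructor
  · intro h
    rw [h, mul_zero] at h7
    simpa [left_ne_zero_of_mul hN, hk] using h7.symm
  · intro h
    rw [h, mul_zero, mul_zero] at h7
    exact (mul_eq_zero.1 h7).resolve_left (right_ne_zero_of_mul hN)

end

/-- This yields the generic nonvanishing of the foliation form: if it vanished on an open set, `D`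
would be locally constant there, hence constant by the identity theorem on `logDomain`. -/
theorem eq_const_of_fderiv_section_eq_zero (S : Uniformization p)
    (hD : IsHolomorphicOnCover p fun e => (D e : ℂ))
    {U : Set (Cn n)} (hU : IsOpen U) (hne : (U ∩ ballCompl n s hs r).Nonempty)
    (h : ∀ (V : Set (Cn n)) (φ : Cn n → E), IsLocalSection p V φ → ∀ x ∈ V ∩ U, ∀ v,
      fderiv ℂ (fun y => (D (φ y) : ℂ)) x v = 0) : ∃ c, ∀ e, D e = c := by
  obtain ⟨x, hxU, hx⟩ := hne
  obtain ⟨z₀, hz₀, rfl⟩ := exists_expCoord_eq hs hx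
  obtain ⟨V, hV, hxV, hVX, hd, hmaps⟩ := exists_logCoord_nhds hs hz₀
  have hφ := S.isLocalSection_logCoord hV hVX hd hmaps
  obtain ⟨ε, hε, hball⟩ := Metric.isOpen_iff.1 (hV.inter hU) _ ⟨hxV, hxU⟩
  have hf : DifferentiableOn ℂ (fun y => (D (S.Q (logCoord s z₀ y)) : ℂ)) (ball (expCoord s z₀) ε) :=
    (hD V _ hφ).mono fun y hy => (hball hy).1
  have hconst : ∀ y ∈ ball (expCoord s z₀) ε, (D (S.Q (logCoord s z₀ y)) : ℂ) =
      D (S.Q (logCoord s z₀ (expCoord s z₀))) := fun y hy =>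
    isOpen_ball.is_const_of_fderiv_eq_zero (convex_ball _ _).isPreconnected hf
      (fun y hy => ContinuousLinearMap.ext fun v => h V _ hφ y (hball hy) v) hy (mem_ball_self hε)
  have hev : ∀ᶠ z in 𝓝 z₀, (D (S.Q z) : ℂ) = D (S.Q (logCoord s z₀ (expCoord s z₀))) := by
    filter_upwards [logCoord_expCoord_eventuallyEq (s := s) z₀,
      (differentiable_expCoord (s := s)).continuous.continuousAt.eventually_mem
        (ball_mem_nhds _ hε)] with z hz hzb
    rw [← hconst _ hzb, hz]
  refine ⟨D (S.Q (logCoord s z₀ (expCoord s z₀))), fun e => UnitDisc.coe_injective ?_⟩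
  simpa [S.Q_Λ] using eqOn_const_of_eventuallyEq_logDomain (S.differentiableOn_comp_Q hD) hz₀ hev
    (S.mem e)

theorem exists_foliation (S : Uniformization p) [PathConnectedSpace E] {e₀ : E}
    {ρ : FundamentalGroup (ballCompl n s hs r) (p e₀) →* DiscAut} (hr : 0 < r) (hp : Continuous p)
    (hD : IsHolomorphicOnCover p fun e => (D e : ℂ)) (hequiv : IsEquivariant p e₀ ρ D)
    (hne : ¬ ∃ c, ∀ e, D e = c) :
    ∃ F : CodimOneFoliation (ball (0 : Cn n) r),
      F.DefinedByLevelSets p (fun e => (D e : ℂ)) ∧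
      ∃ T : ProjectiveTriple (ball (0 : Cn n) r),
        T.IsTransverseStructureFor F ∧
        (∀ x ∈ ballCompl n s hs r, T.q x ≠ 0) ∧
        T.IsDevelopingMap p (fun e => (D e : ℂ)) := by
  obtain ⟨a, b, c, d, hN, u, ν, μ, hu, hνμ, hDW⟩ := S.hasNormalForm hr hp hD hequiv hne
  have hF : ∀ e, (D e : ℂ) * (c * elementaryForm hs u ν μ (S.Λ e) + d) =
      a * elementaryForm hs u ν μ (S.Λ e) + b := fun e => by
    simpa only [S.Q_Λ] using hDW _ (S.mem e)
  have hiff := fun {U φ} (hφ : IsLocalSection p U φ) {x} (hx : x ∈ U) v =>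
    S.fderiv_section_eq_zero_iff hN hu hνμ hD hF hφ hx v
  refine ⟨⟨foliationForm hs u ν μ, differentiableOn_foliationForm hs hu, ?_,
    fun x hx v w t => foliationForm_integrable hs hu hνμ hx v w t⟩, ?_,
    elementaryTriple hs hu hνμ, ?_, fun x hx => (coordProd_ne_zero_iff hs).2 hx.2,
    S.isDevelopingMap hu hνμ hF hN⟩
  · intro U hU hUne hUX
    by_contra! h
    refine hne (S.eq_const_of_fderiv_section_eq_zero hD hU
      (isOpen_ball_inter_ballCompl_nonempty hs hU hUne hUX) fun V φ hφ x hx v => ?_)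
    rw [hiff hφ hx.1, h x hx.2]
    rfl
  · intro U φ hφ
    ext v
    exact and_congr_right fun _ => forall₂_congr fun x hx => (hiff hφ hx (v x)).symm
  · intro U _ hUX hq
    ext v
    refine and_congr_right fun _ => forall₂_congr fun x hx => ?_
    rw [riccatiForm_elementaryTriple hs hu hνμ (hUX hx) (hq x hx)]
    rw [neg_eq_zero, mul_eq_zero]
    exact (or_iff_right (inv_ne_zero (hq x hx : coordProd hs x ≠ 0))).symm

end Uniformization

end

theorem mainTheorem7 (n s : ℕ) (hs : s ≤ n) (r : ℝ) (hr : 0 < r)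
    {E : Type*} [TopologicalSpace E] [SimplyConnectedSpace E]
    (p : E → ballCompl n s hs r) (hp : IsCoveringMap p) (e₀ : E)
    (ρ : FundamentalGroup (ballCompl n s hs r) (p e₀) →* DiscAut)
    (D : E → 𝔻) (hD : IsHolomorphicOnCover p (fun e => (D e : ℂ)))
    (hequiv : IsEquivariant p e₀ ρ D) :
    ((¬ ∃ c, ∀ e, D e = c) → ¬ IsHyperbolicType ρ) ∧
    (∀ h : 𝔻 ≃ ℍ, IsParabolicVia ρ h →
      ∃ (g : Cn n → ℂ) (lam : Fin s → ℝ) (ℓ : Fin s → E → ℂ),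
        DifferentiableOn ℂ g (Metric.ball (0 : Cn n) r) ∧ (∀ i, 0 ≤ lam i) ∧
        (∀ i, IsLogBranch p (Fin.castLE hs i) (ℓ i)) ∧
        ∀ e, (h (D e) : ℂ) =
          1 / (2 * Real.pi * Complex.I) * ∑ i, (lam i : ℂ) * ℓ i e + g (p e)) ∧
    (∀ h : DiscAut, IsEllipticVia ρ h →
      ∃ (u : Cn n → ℂ) (ν : Fin s → ℝ) (ℓ : Fin s → E → ℂ),
        DifferentiableOn ℂ u (Metric.ball (0 : Cn n) r) ∧ (∀ i, 0 ≤ ν i ∧ ν i < 1) ∧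
        (∀ i, IsLogBranch p (Fin.castLE hs i) (ℓ i)) ∧
        ∀ e, (h.1 (D e) : ℂ) = u (p e) * ∏ i, Complex.exp ((ν i : ℂ) * ℓ i e)) ∧
    ((¬ ∃ c, ∀ e, D e = c) →
      ∃ F : CodimOneFoliation (Metric.ball (0 : Cn n) r),
        F.DefinedByLevelSets p (fun e => (D e : ℂ)) ∧
        ∃ S : ProjectiveTriple (Metric.ball (0 : Cn n) r),
          S.IsTransverseStructureFor F ∧
          (∀ x ∈ ballCompl n s hs r, S.q x ≠ 0) ∧
          S.IsDevelopingMap p (fun e => (D e : ℂ))) := by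
  obtain ⟨S⟩ := nonempty_uniformization hr hp e₀
  exact ⟨fun _ => S.not_isHyperbolicType hr hp hD hequiv,
    fun h hρ => S.parabolic hr hp.continuous hD hequiv hρ,
    fun h hρ => S.elliptic hp.continuous hD hequiv hρ,
    S.exists_foliation hr hp.continuous hD hequiv⟩
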